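/- Let $n$ be a natural number and $\hbar>0$. Let $\mathcal H=L^2(\mathbb R^n;\mathbb C)$ with the usual (Schrödinger) position and momentum operators: $Q_i$ is multiplication by $x_i$ and $P_j=-\mathrm i\hbar\,\partial_j$, so that $[Q_i,P_j]=\mathrm i\hbar\,\delta_{ij}$. Let $\mathsf Q$ and $\mathsf P$ be the joint projection valued measures on $\mathbb R^n$ of $(Q_1,\dots,Q_n)$ and $(P_1,\dots,P_n)$. A state is a positive trace class operator $\rho$ on $\mathcal H$ with $\operatorname{Tr}\rho=1$; its position and momentum distributions are $\mathsf Q_\rho(\cdot)=\operatorname{Tr}\{\rho\,\mathsf Q(\cdot)\}$ and $\mathsf P_\rho(\cdot)=\operatorname{Tr}\{\rho\,\mathsf P(\cdot)\}$. Let $\mathcal S_2$ be the set of the states with $\int|x|^2\,\mathsf Q_\rho(\mathrm dx)<\infty$ and $\int|p|^2\,\mathsf P_\rho(\mathrm dp)<\infty$. For $\rho\in\mathcal S_2$ let $a^\rho,b^\rho\in\mathbb R^n$ and $A^\rho,B^\rho\in\mathbb R^{n\times n}$ be the mean vectors and the variance matrices of $\mathsf Q_\rho$ and $\mathsf P_\rho$,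 let $$C^\rho_{ij}=\operatorname{Tr}\Big\{\rho\,\tfrac{(Q_i-a^\rho_i)(P_j-b^\rho_j)+(P_j-b^\rho_j)(Q_i-a^\rho_i)}2\Big\}:=\operatorname{Re}\operatorname{Tr}\big\{\big((Q_i-a^\rho_i)\sqrt\rho\big)^*(P_j-b^\rho_j)\sqrt\rho\big\},$$ and call $V^\rho=\begin{pmatrix}A^\rho&C^\rho\\(C^\rho)^T&B^\rho\end{pmatrix}$ the quantum variance matrix of $\rho$. 1. Let $A$ and $B$ be real symmetric positive definite $n\times n$ matrices. There is a state $\rho\in\mathcal S_2$ such that $A$ and $B$ are the diagonal blocks of $V^\rho$ (that is, $A^\rho=A$ and $B^\rho=B$) if and only if $B\ge\frac{\hbar^2}4A^{-1}$, i.e. $B-\frac{\hbar^2}4A^{-1}$ is positive semidefinite. 2. Let $u,v\in\mathbb R^n$ be unit vectors with $u\cdot v=\cos\alpha$, and let $\mathsf Q_{u,\rho}$ and $\mathsf P_{v,\rho}$ be the distributions in the state $\rho$ of the observables $Q_u=u\cdot Q$ and $P_v=v\cdot P$. Let $c_Q>0$ and $c_P>0$ be real numbers. There is a state $\rho\in\mathcal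 S_2$ with $\operatorname{Var}(\mathsf Q_{u,\rho})=c_Q$ and $\operatorname{Var}(\mathsf P_{v,\rho})=c_P$ if and only if $c_Q\,c_P\ge\left(\frac\hbar2\cos\alpha\right)^2$. -/

import Mathlib

open MeasureTheory
open scoped ENNReal InnerProductSpace

noncomputable section

namespace QVar

/-! ### Trace and states on a complex Hilbert space -/

section Hilbert

variable (H : Type*) [NormedAddCommGroup H] [InnerProductSpace ℂ H] [CompleteSpace H]

/-- Index set of a fixed orthonormal (Hilbert) basis of `H`. -/
def onbIndex : Set H := (exists_hilbertBasis ℂ H).choose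

/-- A fixed orthonormal (Hilbert) basis of `H`. -/
def onb : HilbertBasis (onbIndex H) ℂ H := (exists_hilbertBasis ℂ H).choose_spec.choose

variable {H}

/-- The trace `Tr T = ∑ₖ ⟨eₖ, T eₖ⟩`; for a trace class operator `T` the value does not depend
on the orthonormal basis. -/
def trace (T : H →L[ℂ] H) : ℂ := ∑' k, ⟪onb H k, T (onb H k)⟫_ℂ

variable (H)

/-- Statistical operators: positive trace class operators of trace one. (A positive operator is
trace class exactly when `∑ₖ ⟨eₖ, ρ eₖ⟩` converges for one orthonormal basis.) -/
structure State where
  op : H →L[ℂ] H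
  isPositive : op.IsPositive
  summable_diag : Summable fun k => ⟪onb H k, op (onb H k)⟫_ℂ
  trace_eq_one : trace op = 1

variable {H}

/-- The positive square root of a state. -/
def State.sqrtOp (ρ : State H) : H →L[ℂ] H := CFC.sqrt ρ.op

theorem State.sqrtOp_mul_self (ρ : State H) : ρ.sqrtOp * ρ.sqrtOp = ρ.op :=
  CFC.sqrt_mul_sqrt_self ρ.op
    ((ContinuousLinearMap.nonneg_iff_isPositive ρ.op).2 ρ.isPositive)

theorem State.sqrtOp_isPositive (ρ : State H) : ρ.sqrtOp.IsPositive :=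
  (ContinuousLinearMap.nonneg_iff_isPositive _).1 (CFC.sqrt_nonneg ρ.op)

theorem State.sqrtOp_symm (ρ : State H) (x y : H) :
    ⟪ρ.sqrtOp x, y⟫_ℂ = ⟪x, ρ.sqrtOp y⟫_ℂ :=
  ρ.sqrtOp_isPositive.isSymmetric x y

theorem State.inner_sqrtOp (ρ : State H) (x y : H) :
    ⟪ρ.sqrtOp x, ρ.sqrtOp y⟫_ℂ = ⟪x, ρ.op y⟫_ℂ := by
  rw [ρ.sqrtOp_symm, ← ρ.sqrtOp_mul_self]; rfl

theorem State.summable_norm_sqrtOp (ρ : State H) :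
    Summable fun k => ‖ρ.sqrtOp (onb H k)‖ ^ 2 := by
  have h := (Complex.reCLM.hasSum ρ.summable_diag.hasSum).summable
  refine h.congr fun k => ?_
  have := inner_self_eq_norm_sq (𝕜 := ℂ) (ρ.sqrtOp (onb H k))
  rw [ρ.inner_sqrtOp] at this
  simpa using this

theorem hasSum_norm_inner_sq (x : H) :
    HasSum (fun k => ‖⟪onb H k, x⟫_ℂ‖ ^ 2) (‖x‖ ^ 2) := by
  have h := Complex.reCLM.hasSum ((onb H).hasSum_inner_mul_inner x x)
  convert h using 1
  · funext k
    have : ⟪x, onb H k⟫_ℂ * ⟪onb H k, x⟫_ℂ = ((‖⟪onb H k, x⟫_ℂ‖ ^ 2 : ℝ) : ℂ) := by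
      rw [← inner_conj_symm, RCLike.conj_mul]; norm_cast
    simp only [this, Complex.reCLM_apply, Complex.ofReal_re]
  · exact (inner_self_eq_norm_sq (𝕜 := ℂ) x).symm

/-- `Tr{ρ X} = ∑ₖ ⟨√ρ eₖ, X √ρ eₖ⟩` for every bounded operator `X`. -/
theorem State.hasSum_trace (ρ : State H) (X : H →L[ℂ] H) :
    HasSum (fun k => ⟪ρ.sqrtOp (onb H k), X (ρ.sqrtOp (onb H k))⟫_ℂ) (trace (ρ.op * X)) := by
  set S := ρ.sqrtOp
  set e := onb H
  let Y := ContinuousLinearMap.adjoint X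
  let f : onbIndex H × onbIndex H → ℂ := fun p => ⟪Y (S (e p.1)), e p.2⟫_ℂ * ⟪e p.2, S (e p.1)⟫_ℂ
  have hS : Summable fun k => ‖S (e k)‖ ^ 2 := ρ.summable_norm_sqrtOp
  have hY : Summable fun k => ‖Y (S (e k))‖ ^ 2 := by
    refine Summable.of_nonneg_of_le (fun _ => by positivity) (fun k => ?_) (hS.mul_left (‖Y‖ ^ 2))
    rw [← mul_pow]
    exact pow_le_pow_left₀ (norm_nonneg _) (Y.le_opNorm _) 2
  have dbl : ∀ g : onbIndex H → H, (Summable fun k => ‖g k‖ ^ 2) →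
      Summable fun p : onbIndex H × onbIndex H => ‖⟪e p.2, g p.1⟫_ℂ‖ ^ 2 := by
    intro g hg
    refine (summable_prod_of_nonneg (fun _ => by positivity)).2
      ⟨fun k => (hasSum_norm_inner_sq (g k)).summable, ?_⟩
    exact hg.congr fun k => (hasSum_norm_inner_sq (g k)).tsum_eq.symm
  have hf : Summable f := by
    refine Summable.of_norm_bounded ((dbl _ hS).add (dbl _ hY)) fun p => ?_
    simp only [f, norm_mul]
    rw [norm_inner_symm (Y _)]
    nlinarith [sq_nonneg (‖⟪e p.2, S (e p.1)⟫_ℂ‖ - ‖⟪e p.2, Y (S (e p.1))⟫_ℂ‖),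
      sq_nonneg ‖⟪e p.2, S (e p.1)⟫_ℂ‖, sq_nonneg ‖⟪e p.2, Y (S (e p.1))⟫_ℂ‖]
  have h1 : ∀ k, HasSum (fun j => f (k, j)) ⟪S (e k), X (S (e k))⟫_ℂ := fun k => by
    have := e.hasSum_inner_mul_inner (Y (S (e k))) (S (e k))
    rwa [ContinuousLinearMap.adjoint_inner_left] at this
  have h2 : ∀ j, HasSum (fun k => f (k, j)) ⟪e j, (ρ.op * X) (e j)⟫_ℂ := fun j => by
    have := e.hasSum_inner_mul_inner (S (e j)) (S (X (e j)))
    rw [ρ.inner_sqrtOp] at this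
    refine this.congr_fun fun k => ?_
    simp only [f, Y]
    rw [ContinuousLinearMap.adjoint_inner_left, ρ.sqrtOp_symm, ρ.sqrtOp_symm, mul_comm]
  have h3 := hf.hasSum.prod_fiberwise h1
  have h4 := ((Equiv.prodComm _ _).hasSum_iff.2 hf.hasSum).prod_fiberwise h2
  have h5 : trace (ρ.op * X) = ∑' p, f p := h4.tsum_eq
  rwa [h5]

end Hilbert

/-! ### Sharp observables -/

/-- Projection valued measures on a measurable space `X` acting in `H`. -/
structure PVM (X : Type*) [MeasurableSpace X] (H : Type*) [NormedAddCommGroup H]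
    [InnerProductSpace ℂ H] [CompleteSpace H] where
  proj : Set X → H →L[ℂ] H
  isStarProjection : ∀ A, MeasurableSet A → IsStarProjection (proj A)
  proj_univ : proj Set.univ = 1
  hasSum_proj : ∀ A : ℕ → Set X, (∀ k, MeasurableSet (A k)) →
    Pairwise (fun j k => Disjoint (A j) (A k)) →
    ∀ φ ψ, HasSum (fun k => ⟪φ, proj (A k) ψ⟫_ℂ) ⟪φ, proj (⋃ k, A k) ψ⟫_ℂ

namespace PVM

variable {X X' : Type*} [MeasurableSpace X] [MeasurableSpace X']
variable {H K : Type*} [NormedAddCommGroup H] [InnerProductSpace ℂ H] [CompleteSpace H]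
  [NormedAddCommGroup K] [InnerProductSpace ℂ K] [CompleteSpace K]

/-- Image of a pvm `E` under a measurable map `f`, that is `A ↦ E (f⁻¹ A)`. -/
def map (E : PVM X H) (f : X → X') (hf : Measurable f) : PVM X' H where
  proj A := E.proj (f ⁻¹' A)
  isStarProjection A hA := E.isStarProjection _ (hf hA)
  proj_univ := by simpa using E.proj_univ
  hasSum_proj A hA hd φ ψ := by
    rw [Set.preimage_iUnion]
    exact E.hasSum_proj _ (fun k => hf (hA k)) (fun j k hjk => (hd hjk).preimage f) φ ψ

/-- The pvm `A ↦ U⁻¹ E(A) U` for a unitary operator `U : K → H`. -/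
def conj (E : PVM X H) (U : K ≃ₗᵢ[ℂ] H) : PVM X K where
  proj A := (U.symm.toContinuousLinearEquiv : H →L[ℂ] K) ∘L E.proj A ∘L
    (U.toContinuousLinearEquiv : K →L[ℂ] H)
  isStarProjection A hA := by
    have h := E.isStarProjection A hA
    constructor
    · have h1 := h.isIdempotentElem
      ext ψ
      have := DFunLike.congr_fun h1 (U ψ)
      simpa using congrArg U.symm this
    · have h2 := ContinuousLinearMap.isSelfAdjoint_iff_isSymmetric.1 h.isSelfAdjoint
      refine ContinuousLinearMap.isSelfAdjoint_iff_isSymmetric.2 fun x y => ?_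
      have h3 : ⟪E.proj A (U x), U y⟫_ℂ = ⟪U x, E.proj A (U y)⟫_ℂ := h2 (U x) (U y)
      have e1 := U.inner_map_map (U.symm (E.proj A (U x))) y
      have e2 := U.inner_map_map x (U.symm (E.proj A (U y)))
      rw [U.apply_symm_apply] at e1 e2
      exact e1.symm.trans (h3.trans e2)
  proj_univ := by ext ψ; simp [E.proj_univ]
  hasSum_proj A hA hd φ ψ := by
    have key : ∀ x : H, ⟪φ, U.symm x⟫_ℂ = ⟪U φ, x⟫_ℂ := fun x => by
      rw [← U.inner_map_map φ, U.apply_symm_apply]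
    have h := E.hasSum_proj A hA hd (U φ) (U ψ)
    simp_rw [← key] at h
    exact h

theorem trace_mul_proj (E : PVM X H) (ρ : State H) {A : Set X} (hA : MeasurableSet A) :
    ENNReal.ofReal (trace (ρ.op * E.proj A)).re =
      ∑' k, ENNReal.ofReal (⟪ρ.sqrtOp (onb H k), E.proj A (ρ.sqrtOp (onb H k))⟫_ℂ).re := by
  have h := Complex.reCLM.hasSum (ρ.hasSum_trace (E.proj A))
  simp only [Complex.reCLM_apply] at h
  rw [← ENNReal.ofReal_tsum_of_nonneg _ h.summable]
  · rw [h.tsum_eq]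
  · intro k
    have := (IsStarProjection.nonneg (E.isStarProjection A hA))
    exact ((ContinuousLinearMap.nonneg_iff_isPositive _).1 this).re_inner_nonneg_right _

/-- The distribution `A ↦ Tr{ρ E(A)}` of the sharp observable `E` in the state `ρ`. -/
def law (E : PVM X H) (ρ : State H) : Measure X :=
  Measure.ofMeasurable (fun A _ => ENNReal.ofReal (trace (ρ.op * E.proj A)).re)
    (by
      have h0 : E.proj ∅ = 0 := by
        ext ψ
        have h := E.hasSum_proj (fun _ => ∅) (fun _ => .empty)
          (fun _ _ _ => Set.disjoint_empty _) (E.proj ∅ ψ) ψ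
        have h2 := (summable_const_iff _).1 h.summable
        simpa using h2
      simp [h0, trace])
    (by
      intro A hA hd
      rw [E.trace_mul_proj ρ (MeasurableSet.iUnion hA)]
      simp_rw [fun i => E.trace_mul_proj ρ (hA i)]
      rw [ENNReal.tsum_comm]
      refine tsum_congr fun k => ?_
      set ψ := ρ.sqrtOp (onb H k)
      have h := Complex.reCLM.hasSum (E.hasSum_proj A hA hd ψ ψ)
      simp only [Complex.reCLM_apply] at h
      rw [← ENNReal.ofReal_tsum_of_nonneg _ h.summable]
      · exact congrArg ENNReal.ofReal h.tsum_eq.symm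
      · intro i
        have := (IsStarProjection.nonneg (E.isStarProjection _ (hA i)))
        exact ((ContinuousLinearMap.nonneg_iff_isPositive _).1 this).re_inner_nonneg_right _)

theorem law_apply (E : PVM X H) (ρ : State H) {A : Set X} (hA : MeasurableSet A) :
    E.law ρ A = ENNReal.ofReal (trace (ρ.op * E.proj A)).re :=
  Measure.ofMeasurable_apply A hA

end PVM

/-! ### Position and momentum in the Schrödinger representation -/

/-- The configuration space `ℝⁿ`. -/
abbrev Conf (n : ℕ) := EuclideanSpace ℝ (Fin n)

/-- The Hilbert space `L²(ℝⁿ; ℂ)`. -/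
abbrev Hilb (n : ℕ) := Lp (α := Conf n) ℂ 2 (volume : Measure (Conf n))

/-- The (unitary) Fourier transform of `L²(ℝⁿ)`, extending
`(𝓕ψ)(ξ) = ∫ exp (-2πi x·ξ) ψ(x) dx`. -/
abbrev fourierL2 (n : ℕ) : Hilb n ≃ₗᵢ[ℂ] Hilb n := Lp.fourierTransformₗᵢ (Conf n) ℂ

open Classical in
/-- Multiplication of `L²` functions by the indicator function of a measurable set `A`. -/
def indicatorMul (n : ℕ) (A : Set (Conf n)) : Hilb n →L[ℂ] Hilb n :=
  if hA : MeasurableSet A then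
    LinearMap.mkContinuous
      { toFun := fun ψ => ((Lp.memLp ψ).indicator hA).toLp (A.indicator ψ)
        map_add' := fun φ ψ => by
          ext1
          filter_upwards [((Lp.memLp (φ + ψ)).indicator hA).coeFn_toLp,
            ((Lp.memLp φ).indicator hA).coeFn_toLp, ((Lp.memLp ψ).indicator hA).coeFn_toLp,
            Lp.coeFn_add φ ψ, Lp.coeFn_add (((Lp.memLp φ).indicator hA).toLp (A.indicator φ))
              (((Lp.memLp ψ).indicator hA).toLp (A.indicator ψ))] with x h1 h2 h3 h4 h5
          rw [h1, h5, Pi.add_apply, h2, h3]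
          simp only [Set.indicator_apply, h4, Pi.add_apply]
          split_ifs <;> simp
        map_smul' := fun c ψ => by
          ext1
          filter_upwards [((Lp.memLp (c • ψ)).indicator hA).coeFn_toLp,
            ((Lp.memLp ψ).indicator hA).coeFn_toLp, Lp.coeFn_smul c ψ,
            Lp.coeFn_smul c (((Lp.memLp ψ).indicator hA).toLp (A.indicator ψ))] with x h1 h2 h3 h4
          rw [h1, RingHom.id_apply, h4, Pi.smul_apply, h2]
          simp only [Set.indicator_apply, h3, Pi.smul_apply]
          split_ifs <;> simp }
      1 (fun ψ => by
        rw [one_mul]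
        refine Lp.norm_le_norm_of_ae_le ?_
        filter_upwards [((Lp.memLp ψ).indicator hA).coeFn_toLp] with x h1
        simp only [LinearMap.coe_mk, AddHom.coe_mk]
        rw [h1]
        exact norm_indicator_le_norm_self _ _)
  else 0

theorem indicatorMul_ae {n : ℕ} {A : Set (Conf n)} (hA : MeasurableSet A) (ψ : Hilb n) :
    indicatorMul n A ψ =ᵐ[volume] A.indicator ψ := by
  rw [indicatorMul, dif_pos hA]
  exact ((Lp.memLp ψ).indicator hA).coeFn_toLp

theorem indicatorMul_symm {n : ℕ} {A : Set (Conf n)} (hA : MeasurableSet A) (φ ψ : Hilb n) :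
    ⟪indicatorMul n A φ, ψ⟫_ℂ = ⟪φ, indicatorMul n A ψ⟫_ℂ := by
  rw [L2.inner_def, L2.inner_def]
  refine integral_congr_ae ?_
  filter_upwards [indicatorMul_ae hA φ, indicatorMul_ae hA ψ] with x h1 h2
  rw [h1, h2]
  by_cases hx : x ∈ A <;> simp [hx]

theorem indicatorMul_idem {n : ℕ} {A : Set (Conf n)} (hA : MeasurableSet A) (ψ : Hilb n) :
    indicatorMul n A (indicatorMul n A ψ) = indicatorMul n A ψ := by
  ext1
  filter_upwards [indicatorMul_ae hA (indicatorMul n A ψ), indicatorMul_ae hA ψ] with x h1 h2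
  rw [h1]
  by_cases hx : x ∈ A <;> simp [hx, h2]

/-- The joint pvm `Q` of the position operators: `Q(A)` is multiplication by `1_A`. -/
def positionPVM (n : ℕ) : PVM (Conf n) (Hilb n) where
  proj := indicatorMul n
  isStarProjection A hA := by
    constructor
    · ext1 ψ; exact indicatorMul_idem hA ψ
    · exact ContinuousLinearMap.isSelfAdjoint_iff_isSymmetric.2 (indicatorMul_symm hA)
  proj_univ := by
    ext1 ψ
    ext1
    filter_upwards [indicatorMul_ae MeasurableSet.univ ψ] with x h1
    rw [h1]; simp
  hasSum_proj A hA hd φ ψ := by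
    have key : ∀ {B : Set (Conf n)}, MeasurableSet B →
        ⟪φ, indicatorMul n B ψ⟫_ℂ = ∫ x in B, ⟪φ x, ψ x⟫_ℂ := fun {B} hB => by
      rw [L2.inner_def, ← integral_indicator hB]
      refine integral_congr_ae ?_
      filter_upwards [indicatorMul_ae hB ψ] with x h1
      rw [h1]
      by_cases hx : x ∈ B <;> simp [hx]
    rw [key (MeasurableSet.iUnion hA)]
    simp_rw [fun k => key (hA k)]
    exact hasSum_integral_iUnion hA hd (L2.integrable_inner φ ψ).integrableOn

/-- The joint pvm `P` of the momentum operators `-iħ∂ⱼ`: since these correspond under the Fourier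
transform to multiplication by `2πħ ξⱼ`, the projection `P(B)` is
`𝓕⁻¹ 1_{ξ : 2πħ ξ ∈ B} 𝓕`. -/
def momentumPVM (n : ℕ) (hbar : ℝ) : PVM (Conf n) (Hilb n) :=
  ((positionPVM n).map (fun ξ => (2 * Real.pi * hbar) • ξ) (by fun_prop)).conj (fourierL2 n)

/-- The pvm of `Q_u = u · Q`. -/
def positionPVMAlong {n : ℕ} (u : Conf n) : PVM ℝ (Hilb n) :=
  (positionPVM n).map (fun x => ⟪u, x⟫_ℝ) (by fun_prop)

/-- The pvm of `P_v = v · P`. -/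
def momentumPVMAlong {n : ℕ} (hbar : ℝ) (v : Conf n) : PVM ℝ (Hilb n) :=
  (momentumPVM n hbar).map (fun p => ⟪v, p⟫_ℝ) (by fun_prop)

theorem mul_add_ae {n : ℕ} (g : Conf n → ℝ) (φ ψ : Hilb n) :
    (fun x => (g x : ℂ) * (φ + ψ : Hilb n) x) =ᵐ[volume]
      (fun x => (g x : ℂ) * φ x) + fun x => (g x : ℂ) * ψ x := by
  filter_upwards [Lp.coeFn_add φ ψ] with x h
  rw [h, Pi.add_apply, Pi.add_apply, mul_add]

theorem mul_smul_ae {n : ℕ} (g : Conf n → ℝ) (c : ℂ) (ψ : Hilb n) :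
    (fun x => (g x : ℂ) * (c • ψ : Hilb n) x) =ᵐ[volume] c • fun x => (g x : ℂ) * ψ x := by
  filter_upwards [Lp.coeFn_smul c ψ] with x h
  rw [h, Pi.smul_apply, Pi.smul_apply, smul_eq_mul, smul_eq_mul, mul_left_comm]

/-- The maximal domain `{ψ ∈ L² | gψ ∈ L²}` of multiplication by `g`. -/
def mulDomain {n : ℕ} (g : Conf n → ℝ) : Submodule ℂ (Hilb n) where
  carrier := {ψ | MemLp (fun x => (g x : ℂ) * ψ x) 2 volume}
  zero_mem' := by
    refine (memLp_congr_ae (g := fun _ => (0 : ℂ)) ?_).2 MemLp.zero'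
    filter_upwards [Lp.coeFn_zero ℂ 2 (volume : Measure (Conf n))] with x h
    rw [h, Pi.zero_apply, mul_zero]
  add_mem' := fun {φ ψ} hφ hψ => (memLp_congr_ae (mul_add_ae g φ ψ)).2 (MemLp.add hφ hψ)
  smul_mem' := fun c ψ hψ => (memLp_congr_ae (mul_smul_ae g c ψ)).2 (MemLp.const_smul hψ c)

/-- The self-adjoint operator of multiplication by a real measurable function `g`, on its maximal
domain. -/
def mulOp {n : ℕ} (g : Conf n → ℝ) : Hilb n →ₗ.[ℂ] Hilb n where
  domain := mulDomain g
  toFun :=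
    { toFun := fun ψ => MemLp.toLp (fun x => (g x : ℂ) * (ψ : Hilb n) x) ψ.2
      map_add' := fun φ ψ => by
        ext1
        have h0 := (φ + ψ).2
        filter_upwards [MemLp.coeFn_toLp h0, MemLp.coeFn_toLp φ.2, MemLp.coeFn_toLp ψ.2,
          mul_add_ae g φ ψ, Lp.coeFn_add (MemLp.toLp _ φ.2) (MemLp.toLp _ ψ.2)] with x h1 h2 h3 h4 h5
        rw [h5, Pi.add_apply, h2, h3]
        exact h1.trans h4
      map_smul' := fun c ψ => by
        ext1
        have h0 := (c • ψ).2
        filter_upwards [MemLp.coeFn_toLp h0, MemLp.coeFn_toLp ψ.2,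
          mul_smul_ae g c ψ, Lp.coeFn_smul c (MemLp.toLp _ ψ.2)] with x h1 h2 h4 h5
        rw [RingHom.id_apply, h5, Pi.smul_apply, h2]
        exact h1.trans h4 }

/-- The position operator `Q_i`, multiplication by `x_i`. -/
def positionOp {n : ℕ} (i : Fin n) : Hilb n →ₗ.[ℂ] Hilb n := mulOp fun x => x i

/-- The operator `U⁻¹ T U` for a unitary operator `U`, with domain `{ψ | U ψ ∈ dom T}`. -/
def conjOp {H : Type*} [NormedAddCommGroup H] [InnerProductSpace ℂ H]
    (T : H →ₗ.[ℂ] H) (U : H ≃ₗᵢ[ℂ] H) : H →ₗ.[ℂ] H where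
  domain := T.domain.comap U.toLinearEquiv.toLinearMap
  toFun :=
    { toFun := fun ψ => U.symm (T ⟨U ψ, ψ.2⟩)
      map_add' := fun φ ψ => by
        rw [← map_add, ← LinearPMap.map_add]
        congr 3
        exact map_add U _ _
      map_smul' := fun c ψ => by
        rw [RingHom.id_apply, ← map_smul, ← LinearPMap.map_smul]
        congr 3
        exact map_smul U _ _ }

/-- The momentum operator `P_j = -iħ∂ⱼ = 𝓕⁻¹ (2πħ ξⱼ) 𝓕`. -/
def momentumOp {n : ℕ} (hbar : ℝ) (j : Fin n) : Hilb n →ₗ.[ℂ] Hilb n :=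
  conjOp (mulOp fun ξ => 2 * Real.pi * hbar * ξ j) (fourierL2 n)

open Classical in
/-- Application of an unbounded operator to a vector (`0` outside the domain). -/
def applyOp {n : ℕ} (T : Hilb n →ₗ.[ℂ] Hilb n) (ψ : Hilb n) : Hilb n :=
  if h : ψ ∈ T.domain then T ⟨ψ, h⟩ else 0

/-! ### Quantum moments -/

variable {n : ℕ}

/-- The states with finite second moments of position and momentum. -/
def FiniteSecondMoments (hbar : ℝ) (ρ : State (Hilb n)) : Prop :=
  ∫⁻ x, ‖x‖ₑ ^ 2 ∂(positionPVM n).law ρ < ∞ ∧ ∫⁻ p, ‖p‖ₑ ^ 2 ∂(momentumPVM n hbar).law ρ < ∞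

/-- Mean position `a^ρ`. -/
def meanQ (ρ : State (Hilb n)) (i : Fin n) : ℝ := ∫ x, x i ∂(positionPVM n).law ρ

/-- Mean momentum `b^ρ`. -/
def meanP (hbar : ℝ) (ρ : State (Hilb n)) (i : Fin n) : ℝ := ∫ p, p i ∂(momentumPVM n hbar).law ρ

/-- Variance matrix `A^ρ` of the position. -/
def varQ (ρ : State (Hilb n)) : Matrix (Fin n) (Fin n) ℝ :=
  .of fun i j => ∫ x, (x i - meanQ ρ i) * (x j - meanQ ρ j) ∂(positionPVM n).law ρ

/-- Variance matrix `B^ρ` of the momentum. -/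
def varP (hbar : ℝ) (ρ : State (Hilb n)) : Matrix (Fin n) (Fin n) ℝ :=
  .of fun i j => ∫ p, (p i - meanP hbar ρ i) * (p j - meanP hbar ρ j) ∂(momentumPVM n hbar).law ρ

/-- Quantum covariances `C^ρ_ij = Tr{ρ (XY + YX)/2}`, `X = Q_i - a_i`, `Y = P_j - b_j`. For the
unbounded operators `X`, `Y` and a state `ρ` with finite second moments, `X√ρ` and `Y√ρ` are
Hilbert-Schmidt and the trace is `Re Tr{(X√ρ)* (Y√ρ)} = Re ∑ₖ ⟨X√ρ eₖ, Y√ρ eₖ⟩`. -/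
def covQP (hbar : ℝ) (ρ : State (Hilb n)) : Matrix (Fin n) (Fin n) ℝ :=
  .of fun i j => (∑' k,
    ⟪applyOp (positionOp i) (ρ.sqrtOp (onb (Hilb n) k))
        - (meanQ ρ i : ℂ) • ρ.sqrtOp (onb (Hilb n) k),
      applyOp (momentumOp hbar j) (ρ.sqrtOp (onb (Hilb n) k))
        - (meanP hbar ρ j : ℂ) • ρ.sqrtOp (onb (Hilb n) k)⟫_ℂ).re

/-- The quantum variance matrix `V^ρ` of position and momentum. -/
def quantumVarianceMatrix (hbar : ℝ) (ρ : State (Hilb n)) :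
    Matrix (Fin n ⊕ Fin n) (Fin n ⊕ Fin n) ℝ :=
  Matrix.fromBlocks (varQ ρ) (covQP hbar ρ) (covQP hbar ρ).transpose (varP hbar ρ)

/-- Variance of the distribution of `Q_u` in the state `ρ`. -/
def varianceQAlong (u : Conf n) (ρ : State (Hilb n)) : ℝ :=
  ProbabilityTheory.variance id ((positionPVMAlong u).law ρ)

/-- Variance of the distribution of `P_v` in the state `ρ`. -/
def variancePAlong (hbar : ℝ) (v : Conf n) (ρ : State (Hilb n)) : ℝ :=
  ProbabilityTheory.variance id ((momentumPVMAlong hbar v).law ρ)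

end QVar

end

/-! Necessity is the Robertson inequality `uncertainty` for `Q_u` and `P_v`, with arbitrary vectors
`u`, `v`. Domain questions for the commutator are avoided by using the Weyl form of the commutation
relations: translation by `tħv` shifts `u·x` by `tħ u·v`, and a finite second moment of `P_v` makes
the translation group Lipschitz in `t` at the given vector. Letting `t → 0` gives the inequality for
a vector (`uncertainty_vector`). A mixed state has the laws of the family `√ρ eₖ`, so the vector
inequalities, all centred at the means of `ρ`, are summed by Cauchy-Schwarz. Taking `u = A⁻¹y` and
`v = y` turns the scalar inequality into the matrix inequality (`posSemidef_varP_sub`).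

Sufficiency uses pure Gaussian states with a quadratic phase. Let `Λ` be the square root of `A`. The
modulus fixes the position covariance `Λ²` and contributes `(ħ²/4)A⁻¹` to the momentum covariance; a
phase with symmetric matrix `R` adds `Λ⁻¹R²Λ⁻¹` without changing the position law. Solving `R² = Λ(B
- (ħ²/4)A⁻¹)Λ` is possible exactly when the excess is positive semidefinite
(`exists_gaussian_vector`, `exists_state_of_posSemidef`). For the second claim it then suffices to
find `A` with `u·Au = c_Q` and `(ħ²/4) v·A⁻¹v ≤ c_P` (`exists_state_of_le`). -/

noncomputable section

namespace QVar

/-! ### Laws of position and momentum as measures with densities -/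

section Laws

variable {n : ℕ}

/-- The measure `|φ(x)|² dx` of a square integrable function `φ`. -/
def bornMeasure (φ : Hilb n) : Measure (Conf n) :=
  volume.withDensity fun x => ‖φ x‖ₑ ^ 2

theorem measurable_enorm_sq (φ : Hilb n) : Measurable fun x => ‖φ x‖ₑ ^ 2 :=
  (Lp.stronglyMeasurable φ).measurable.enorm.pow_const 2

theorem inner_indicatorMul_self {A : Set (Conf n)} (hA : MeasurableSet A) (φ : Hilb n) :
    ⟪φ, indicatorMul n A φ⟫_ℂ = ∫ x in A, ((‖φ x‖ ^ 2 : ℝ) : ℂ) := by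
  rw [L2.inner_def, ← integral_indicator hA]
  refine integral_congr_ae ?_
  filter_upwards [indicatorMul_ae hA φ] with x h1
  rw [h1]
  by_cases hx : x ∈ A
  · simp [hx]
  · simp [hx]

theorem ofReal_inner_indicatorMul_self {A : Set (Conf n)} (hA : MeasurableSet A) (φ : Hilb n) :
    ENNReal.ofReal (⟪φ, indicatorMul n A φ⟫_ℂ).re = bornMeasure φ A := by
  have hint : Integrable fun x => ‖φ x‖ ^ 2 :=
    (memLp_two_iff_integrable_sq_norm (Lp.aestronglyMeasurable φ)).1 (Lp.memLp φ)
  rw [inner_indicatorMul_self hA, integral_complex_ofReal, Complex.ofReal_re, bornMeasure,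
    withDensity_apply _ hA, ofReal_integral_eq_lintegral_ofReal hint.integrableOn
      (Filter.Eventually.of_forall fun x => by positivity)]
  refine lintegral_congr fun x => ?_
  rw [ENNReal.ofReal_pow (norm_nonneg _), ofReal_norm]

/-- Splitting `ρ` as `√ρ √ρ` inside the trace makes a mixed state an incoherent sum of the
unnormalised vectors `√ρ eₖ`, so no spectral decomposition of `ρ` is needed. -/
theorem position_law_eq (ρ : State (Hilb n)) :
    (positionPVM n).law ρ =
      Measure.sum fun k => bornMeasure (ρ.sqrtOp (onb (Hilb n) k)) := by
  ext A hA
  rw [PVM.law_apply _ _ hA, PVM.trace_mul_proj _ _ hA, Measure.sum_apply _ hA]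
  exact tsum_congr fun k => ofReal_inner_indicatorMul_self hA _

theorem inner_momentum_proj (hbar : ℝ) (A : Set (Conf n)) (φ : Hilb n) :
    ⟪φ, (momentumPVM n hbar).proj A φ⟫_ℂ =
      ⟪fourierL2 n φ, indicatorMul n ((fun ξ => (2 * Real.pi * hbar) • ξ) ⁻¹' A)
        (fourierL2 n φ)⟫_ℂ := by
  rw [← (fourierL2 n).symm.inner_map_map (fourierL2 n φ), LinearIsometryEquiv.symm_apply_apply]
  rfl

theorem measurable_momentum_scale (hbar : ℝ) :
    Measurable fun ξ : Conf n => (2 * Real.pi * hbar) • ξ := by fun_prop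

theorem momentum_law_eq (hbar : ℝ) (ρ : State (Hilb n)) :
    (momentumPVM n hbar).law ρ =
      (Measure.sum fun k => bornMeasure (fourierL2 n (ρ.sqrtOp (onb (Hilb n) k)))).map
        fun ξ => (2 * Real.pi * hbar) • ξ := by
  have hm := measurable_momentum_scale (n := n) hbar
  ext A hA
  rw [PVM.law_apply _ _ hA, PVM.trace_mul_proj _ _ hA, Measure.map_apply hm hA,
    Measure.sum_apply _ (hm hA)]
  refine tsum_congr fun k => ?_
  rw [inner_momentum_proj]
  exact ofReal_inner_indicatorMul_self (hm hA) _

/-- The distribution of the image of a pvm is the image of the distribution. -/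
theorem PVM.law_map {X X' H : Type*} [MeasurableSpace X] [MeasurableSpace X']
    [NormedAddCommGroup H] [InnerProductSpace ℂ H] [CompleteSpace H] (E : PVM X H) {f : X → X'}
    (hf : Measurable f) (ρ : State H) : (E.map f hf).law ρ = (E.law ρ).map f := by
  ext A hA
  rw [Measure.map_apply hf hA, PVM.law_apply _ _ hA, PVM.law_apply _ _ (hf hA)]
  rfl

instance PVM.isProbabilityMeasure_law {X H : Type*} [MeasurableSpace X]
    [NormedAddCommGroup H] [InnerProductSpace ℂ H] [CompleteSpace H] (E : PVM X H)
    (ρ : State H) : IsProbabilityMeasure (E.law ρ) :=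
  ⟨by rw [PVM.law_apply _ _ .univ, E.proj_univ, mul_one, ρ.trace_eq_one]; simp⟩

end Laws

/-! ### Pure states -/

section Pure

variable {H : Type*} [NormedAddCommGroup H] [InnerProductSpace ℂ H] [CompleteSpace H]

/-- This is Parseval's identity for the pair `X*ψ`, `ψ`. -/
theorem hasSum_diag_rankOne_mul (ψ : H) (X : H →L[ℂ] H) :
    HasSum (fun k => ⟪onb H k, (InnerProductSpace.rankOne ℂ ψ ψ * X) (onb H k)⟫_ℂ)
      ⟪ψ, X ψ⟫_ℂ := by
  have h := (onb H).hasSum_inner_mul_inner (ContinuousLinearMap.adjoint X ψ) ψ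
  rw [ContinuousLinearMap.adjoint_inner_left] at h
  refine h.congr_fun fun k => ?_
  change ⟪_, InnerProductSpace.rankOne ℂ ψ ψ (X _)⟫_ℂ = _
  rw [ContinuousLinearMap.adjoint_inner_left, InnerProductSpace.rankOne_apply, inner_smul_right]

/-- The pure state of a unit vector. -/
def pureState (ψ : H) (hψ : ‖ψ‖ = 1) : State H where
  op := InnerProductSpace.rankOne ℂ ψ ψ
  isPositive := InnerProductSpace.isPositive_rankOne_self ψ
  summable_diag := by simpa using (hasSum_diag_rankOne_mul ψ 1).summable
  trace_eq_one := by
    have h := (hasSum_diag_rankOne_mul ψ 1).tsum_eq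
    rw [mul_one] at h
    rw [trace, h, one_apply_eq_self, inner_self_eq_norm_sq_to_K, hψ]
    simp

theorem trace_pureState_mul (ψ : H) (hψ : ‖ψ‖ = 1) (X : H →L[ℂ] H) :
    trace ((pureState ψ hψ).op * X) = ⟪ψ, X ψ⟫_ℂ :=
  (hasSum_diag_rankOne_mul ψ X).tsum_eq

theorem position_law_pureState {n : ℕ} (ψ : Hilb n) (hψ : ‖ψ‖ = 1) :
    (positionPVM n).law (pureState ψ hψ) = bornMeasure ψ := by
  ext A hA
  rw [PVM.law_apply _ _ hA, trace_pureState_mul]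
  exact ofReal_inner_indicatorMul_self hA _

theorem momentum_law_pureState {n : ℕ} (hbar : ℝ) (ψ : Hilb n) (hψ : ‖ψ‖ = 1) :
    (momentumPVM n hbar).law (pureState ψ hψ) =
      (bornMeasure (fourierL2 n ψ)).map fun ξ => (2 * Real.pi * hbar) • ξ := by
  have hm := measurable_momentum_scale (n := n) hbar
  ext A hA
  rw [PVM.law_apply _ _ hA, trace_pureState_mul, Measure.map_apply hm hA, inner_momentum_proj]
  exact ofReal_inner_indicatorMul_self (hm hA) _

end Pure

/-! ### Translations and the Fourier transform -/

section Translation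

variable {n : ℕ}

/-- The translation `ψ ↦ ψ(· - τ)` on `L²`. -/
def translation (τ : Conf n) : Hilb n →ₗᵢ[ℂ] Hilb n :=
  Lp.compMeasurePreservingₗᵢ ℂ (fun x => x - τ) (measurePreserving_sub_right volume τ)

theorem translation_ae (τ : Conf n) (ψ : Hilb n) :
    translation τ ψ =ᵐ[volume] fun x => ψ (x - τ) :=
  Lp.coeFn_compMeasurePreserving ψ (measurePreserving_sub_right volume τ)

theorem memLp_top_phase (τ : Conf n) :
    MemLp (fun ξ : Conf n => Complex.exp (-(2 * Real.pi * ⟪τ, ξ⟫_ℝ : ℝ) * Complex.I)) ∞ volume := by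
  refine memLp_top_of_bound (by fun_prop) 1 (Filter.Eventually.of_forall fun ξ => ?_)
  rw [← Complex.ofReal_neg, Complex.norm_exp_ofReal_mul_I]

/-- Multiplication by the phase `exp (-2πi τ·ξ)` on `L²`. -/
def phaseMul (τ : Conf n) : Hilb n →L[ℂ] Hilb n :=
  (ContinuousLinearMap.mul ℂ ℂ).holderL volume ∞ 2 2 ((memLp_top_phase τ).toLp _)

theorem phaseMul_ae (τ : Conf n) (ψ : Hilb n) :
    phaseMul τ ψ =ᵐ[volume]
      fun ξ => Complex.exp (-(2 * Real.pi * ⟪τ, ξ⟫_ℝ : ℝ) * Complex.I) * ψ ξ := by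
  have h := (ContinuousLinearMap.mul ℂ ℂ).coeFn_holder (r := 2) ((memLp_top_phase τ).toLp _) ψ
  filter_upwards [h, (memLp_top_phase τ).coeFn_toLp] with ξ h1 h2
  rw [phaseMul]
  refine h1.trans ?_
  rw [h2]
  rfl

-- Both sides are continuous in `ψ`, so it is enough to check Schwartz functions, where the
-- transform is given by an integral and the substitution is explicit.
open FourierTransform in
theorem fourier_translation (τ : Conf n) (ψ : Hilb n) :
    fourierL2 n (translation τ ψ) = phaseMul τ (fourierL2 n ψ) := by
  refine DenseRange.induction_on (p := fun ψ : Hilb n =>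
    fourierL2 n (translation τ ψ) = phaseMul τ (fourierL2 n ψ))
    (SchwartzMap.denseRange_toLpCLM (p := 2) ENNReal.ofNat_ne_top) ψ ?_ ?_
  · exact isClosed_eq ((fourierL2 n).continuous.comp (translation τ).continuous)
      ((phaseMul τ).continuous.comp (fourierL2 n).continuous)
  intro f
  have h1 : translation τ (f.toLp 2 volume) = (f.compSubConstCLM ℂ τ).toLp 2 volume := by
    have h0 : ∀ᵐ x ∂(volume : Measure (Conf n)), (f.toLp 2 volume : Hilb n) x = f x :=
      f.coeFn_toLp 2 volume
    ext1
    filter_upwards [translation_ae τ (f.toLp 2 volume),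
      (f.compSubConstCLM ℂ τ).coeFn_toLp 2 volume,
      (measurePreserving_sub_right volume τ).quasiMeasurePreserving.ae h0] with x h1 h2 h3
    rw [h1, h2, h3]
    rfl
  have h2 : ∀ g : SchwartzMap (Conf n) ℂ, fourierL2 n (g.toLp 2 volume) = (𝓕 g).toLp 2 volume :=
    fun g => g.toLp_fourier_eq
  change fourierL2 n (translation τ (f.toLp 2 volume)) =
    phaseMul τ (fourierL2 n (f.toLp 2 volume))
  rw [h1, h2, h2]
  ext1
  filter_upwards [(𝓕 (f.compSubConstCLM ℂ τ)).coeFn_toLp 2 volume,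
    (𝓕 f).coeFn_toLp 2 volume, phaseMul_ae τ ((𝓕 f).toLp 2 volume)] with ξ h3 h4 h5
  rw [h3, h5, h4, SchwartzMap.fourier_coe, SchwartzMap.fourier_coe]
  have h6 := congrFun (VectorFourier.fourierIntegral_comp_add_right Real.fourierChar volume
    (innerₗ (Conf n)) f (-τ)) ξ
  refine Eq.trans ?_ (h6.trans ?_)
  · rfl
  · simp only [map_neg, LinearMap.neg_apply, innerₗ_apply_apply]
    rw [Circle.smul_def, Real.fourierChar_apply, smul_eq_mul]
    congr 2
    push_cast
    ring

end Translation

/-! ### The uncertainty relation -/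

section Uncertainty

variable {n : ℕ}

theorem norm_sq_eq_integral (φ : Hilb n) : ‖φ‖ ^ 2 = ∫ x, ‖φ x‖ ^ 2 := by
  have h : ((‖φ‖ ^ 2 : ℝ) : ℂ) = ((∫ x, ‖φ x‖ ^ 2 : ℝ) : ℂ) := by
    have h1 := inner_self_eq_norm_sq_to_K (𝕜 := ℂ) φ
    rw [L2.inner_def] at h1
    rw [← integral_complex_ofReal]
    push_cast
    refine h1.symm.trans (integral_congr_ae (Filter.Eventually.of_forall fun x => ?_))
    exact inner_self_eq_norm_sq_to_K (𝕜 := ℂ) (φ x)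
  exact_mod_cast h

theorem memLp_mul_of_integrable {g : Conf n → ℝ} (hg : Measurable g) {φ : Hilb n}
    (hint : Integrable fun x => g x ^ 2 * ‖φ x‖ ^ 2) :
    MemLp (fun x => (g x : ℂ) * φ x) 2 volume := by
  refine (memLp_two_iff_integrable_sq_norm ?_).2 ?_
  · exact (Complex.measurable_ofReal.comp hg).aestronglyMeasurable.mul (Lp.aestronglyMeasurable φ)
  · simpa [mul_pow] using hint

/-- The unitary group `e^{-it(P_v - b)}` acting on `L²`. -/
def weylShift (hbar : ℝ) (v : Conf n) (b t : ℝ) (ψ : Hilb n) : Hilb n :=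
  Complex.exp ((t * b : ℝ) * Complex.I) • translation ((t * hbar) • v) ψ

theorem weylShift_ae (hbar : ℝ) (v : Conf n) (b t : ℝ) (ψ : Hilb n) :
    weylShift hbar v b t ψ =ᵐ[volume]
      fun x => Complex.exp ((t * b : ℝ) * Complex.I) * ψ (x - (t * hbar) • v) := by
  filter_upwards [Lp.coeFn_smul (Complex.exp ((t * b : ℝ) * Complex.I))
    (translation ((t * hbar) • v) ψ), translation_ae ((t * hbar) • v) ψ] with x h1 h2
  rw [weylShift, h1, Pi.smul_apply, h2, smul_eq_mul]

theorem fourier_weylShift_ae (hbar : ℝ) (v : Conf n) (b t : ℝ) (ψ : Hilb n) :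
    fourierL2 n (weylShift hbar v b t ψ) =ᵐ[volume] fun ξ =>
      Complex.exp (Complex.I * (-t * (⟪v, (2 * Real.pi * hbar) • ξ⟫_ℝ - b) : ℝ)) *
        fourierL2 n ψ ξ := by
  rw [weylShift, map_smul, fourier_translation]
  filter_upwards [Lp.coeFn_smul (Complex.exp ((t * b : ℝ) * Complex.I))
    (phaseMul ((t * hbar) • v) (fourierL2 n ψ)),
    phaseMul_ae ((t * hbar) • v) (fourierL2 n ψ)] with ξ h1 h2
  rw [h1, Pi.smul_apply, h2, smul_eq_mul, ← mul_assoc, ← Complex.exp_add, inner_smul_left,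
    inner_smul_right]
  congr 2
  push_cast
  simp only [conj_trivial]
  push_cast
  ring

/-- On the Fourier side the group is multiplication by a phase, and `|e^{is} - 1| ≤ |s|`. This
Lipschitz bound replaces differentiation of the group at `t = 0`. -/
theorem norm_weylShift_sub_le (hbar : ℝ) (v : Conf n) (b t : ℝ) (ψ : Hilb n)
    (hint : Integrable fun ξ =>
      (⟪v, (2 * Real.pi * hbar) • ξ⟫_ℝ - b) ^ 2 * ‖fourierL2 n ψ ξ‖ ^ 2) :
    ‖weylShift hbar v b t ψ - ψ‖ ≤ |t| * √(∫ ξ,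
      (⟪v, (2 * Real.pi * hbar) • ξ⟫_ℝ - b) ^ 2 * ‖fourierL2 n ψ ξ‖ ^ 2) := by
  refine abs_le_of_sq_le_sq' ?_ (by positivity) |>.2
  rw [← (fourierL2 n).norm_map, map_sub, norm_sq_eq_integral, mul_pow, sq_abs, Real.sq_sqrt
    (integral_nonneg fun ξ => by positivity), ← integral_const_mul]
  refine integral_mono_of_nonneg (Filter.Eventually.of_forall fun ξ => by positivity)
    (hint.const_mul _) ?_
  filter_upwards [fourier_weylShift_ae hbar v b t ψ,
    Lp.coeFn_sub (fourierL2 n (weylShift hbar v b t ψ)) (fourierL2 n ψ)] with ξ h1 h2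
  rw [h2, Pi.sub_apply, h1, ← sub_one_mul, norm_mul, mul_pow, ← mul_assoc]
  gcongr
  rw [← mul_pow]
  refine (pow_le_pow_left₀ (norm_nonneg _) (Real.norm_exp_I_mul_ofReal_sub_one_le) 2).trans ?_
  rw [Real.norm_eq_abs, sq_abs, neg_mul, neg_sq]

/-- The Weyl form of the commutation relation: substituting `x ↦ x + tħv` moves the shift to the
other argument as its inverse and changes the multiplier `u·x - a` by `tħ u·v`. Only `gψ ∈ L²` is
needed; the shifted vector is never multiplied by `u·x`. -/
theorem inner_mul_weylShift (hbar : ℝ) (u v : Conf n) (a b t : ℝ) (ψ gψ : Hilb n)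
    (hgψ : gψ =ᵐ[volume] fun x => ((⟪u, x⟫_ℝ - a : ℝ) : ℂ) * ψ x) :
    ⟪gψ, weylShift hbar v b t ψ⟫_ℂ =
      ⟪weylShift hbar v b (-t) ψ, gψ + ((t * hbar * ⟪u, v⟫_ℝ : ℝ) : ℂ) • ψ⟫_ℂ := by
  set τ := (t * hbar) • v with hτ
  have hq := (measurePreserving_add_right volume τ).quasiMeasurePreserving
  rw [L2.inner_def, L2.inner_def, ← integral_add_right_eq_self _ τ]
  refine integral_congr_ae ?_
  filter_upwards [hq.ae hgψ, hq.ae (weylShift_ae hbar v b t ψ), weylShift_ae hbar v b (-t) ψ,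
    Lp.coeFn_add gψ (((t * hbar * ⟪u, v⟫_ℝ : ℝ) : ℂ) • ψ),
    Lp.coeFn_smul ((t * hbar * ⟪u, v⟫_ℝ : ℝ) : ℂ) ψ, hgψ] with x h1 h2 h3 h4 h5 h6
  have e1 : x - (-t * hbar) • v = x + τ := by rw [hτ, neg_mul, neg_smul, sub_neg_eq_add]
  rw [h1, h2, h3, h4, Pi.add_apply, h5, Pi.smul_apply, h6, e1, add_sub_cancel_right,
    inner_add_right, hτ, inner_smul_right]
  simp only [RCLike.inner_apply, map_mul, ← Complex.exp_conj, Complex.conj_ofReal, Complex.conj_I,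
    smul_eq_mul]
  push_cast
  have e2 : -(t : ℂ) * b * -Complex.I = t * b * Complex.I := by ring
  rw [e2]
  ring

/-- The uncertainty relation for `Q_u - a` and `P_v - b` in a vector state. -/
theorem uncertainty_vector (hbar : ℝ) (u v : Conf n) (a b : ℝ) (ψ : Hilb n)
    (hQ : Integrable fun x => (⟪u, x⟫_ℝ - a) ^ 2 * ‖ψ x‖ ^ 2)
    (hP : Integrable fun ξ =>
      (⟪v, (2 * Real.pi * hbar) • ξ⟫_ℝ - b) ^ 2 * ‖fourierL2 n ψ ξ‖ ^ 2) :
    |hbar * ⟪u, v⟫_ℝ| * ‖ψ‖ ^ 2 ≤ 2 * √(∫ x, (⟪u, x⟫_ℝ - a) ^ 2 * ‖ψ x‖ ^ 2) *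
      √(∫ ξ, (⟪v, (2 * Real.pi * hbar) • ξ⟫_ℝ - b) ^ 2 * ‖fourierL2 n ψ ξ‖ ^ 2) := by
  have hmem := memLp_mul_of_integrable (g := fun x => ⟪u, x⟫_ℝ - a) (by fun_prop) hQ
  set gψ : Hilb n := hmem.toLp _
  have hgψ : gψ =ᵐ[volume] fun x => ((⟪u, x⟫_ℝ - a : ℝ) : ℂ) * ψ x := hmem.coeFn_toLp
  have hgn : ‖gψ‖ = √(∫ x, (⟪u, x⟫_ℝ - a) ^ 2 * ‖ψ x‖ ^ 2) := by
    rw [eq_comm, Real.sqrt_eq_iff_eq_sq (integral_nonneg fun x => by positivity) (norm_nonneg _),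
      norm_sq_eq_integral]
    refine integral_congr_ae ?_
    filter_upwards [hgψ] with x h
    rw [h, norm_mul, mul_pow, Complex.norm_real, Real.norm_eq_abs, sq_abs]
  rw [← hgn]
  set p := √(∫ ξ, (⟪v, (2 * Real.pi * hbar) • ξ⟫_ℝ - b) ^ 2 * ‖fourierL2 n ψ ξ‖ ^ 2)
  have hW : ∀ t, ‖weylShift hbar v b t ψ - ψ‖ ≤ |t| * p :=
    fun t => norm_weylShift_sub_le hbar v b t ψ hP
  set c := hbar * ⟪u, v⟫_ℝ
  -- The inequality with an error of order `t`, which disappears as `t → 0+`.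
  have key : ∀ t : ℝ, 0 < t → |c| * ‖ψ‖ ^ 2 ≤ 2 * ‖gψ‖ * p + t * (|c| * p * ‖ψ‖) := by
    intro t ht
    set W := weylShift hbar v b t ψ
    set W' := weylShift hbar v b (-t) ψ
    have hW1 : ‖W - ψ‖ ≤ t * p := by simpa [abs_of_pos ht] using hW t
    have hW2 : ‖W' - ψ‖ ≤ t * p := by simpa [abs_of_pos ht] using hW (-t)
    have hsym : ⟪gψ, ψ⟫_ℂ = ⟪ψ, gψ⟫_ℂ := by
      rw [L2.inner_def, L2.inner_def]
      refine integral_congr_ae ?_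
      filter_upwards [hgψ] with x h
      rw [h]
      simp only [RCLike.inner_apply, map_mul, Complex.conj_ofReal]
      ring
    -- A difference-quotient version of the commutator identity: symmetry of multiplication cancels
    -- the zeroth-order terms. Both remaining differences have norm at most `tp`, so a factor `t`
    -- can be divided out.
    have h1 : ((t * c : ℝ) : ℂ) * ⟪W', ψ⟫_ℂ = ⟪gψ, W - ψ⟫_ℂ - ⟪W' - ψ, gψ⟫_ℂ := by
      have h := inner_mul_weylShift hbar u v a b t ψ gψ hgψ
      rw [inner_add_right, inner_smul_right, mul_assoc] at h
      rw [inner_sub_right, inner_sub_left, hsym, h]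
      ring
    have h2 : t * |c| * ‖⟪W', ψ⟫_ℂ‖ ≤ 2 * ‖gψ‖ * (t * p) := by
      calc t * |c| * ‖⟪W', ψ⟫_ℂ‖ = ‖⟪gψ, W - ψ⟫_ℂ - ⟪W' - ψ, gψ⟫_ℂ‖ := by
            rw [← h1, norm_mul, Complex.norm_real, Real.norm_eq_abs, abs_mul t, abs_of_pos ht]
        _ ≤ ‖gψ‖ * ‖W - ψ‖ + ‖W' - ψ‖ * ‖gψ‖ :=
            (norm_sub_le _ _).trans (add_le_add (norm_inner_le_norm _ _) (norm_inner_le_norm _ _))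
        _ ≤ ‖gψ‖ * (t * p) + (t * p) * ‖gψ‖ := by gcongr
        _ = _ := by ring
    have h3 : |c| * ‖⟪W', ψ⟫_ℂ‖ ≤ 2 * ‖gψ‖ * p := by
      refine le_of_mul_le_mul_left ?_ ht
      linarith
    have h4 : ‖ψ‖ ^ 2 ≤ ‖⟪W', ψ⟫_ℂ‖ + t * p * ‖ψ‖ := by
      have e : ⟪ψ, ψ⟫_ℂ = ⟪W', ψ⟫_ℂ - ⟪W' - ψ, ψ⟫_ℂ := by rw [inner_sub_left]; ring
      calc ‖ψ‖ ^ 2 = ‖⟪ψ, ψ⟫_ℂ‖ := by rw [inner_self_eq_norm_sq_to_K]; simp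
        _ ≤ ‖⟪W', ψ⟫_ℂ‖ + ‖W' - ψ‖ * ‖ψ‖ := by
            rw [e]
            exact (norm_sub_le _ _).trans (add_le_add_right (norm_inner_le_norm _ _) _)
        _ ≤ _ := by gcongr
    calc |c| * ‖ψ‖ ^ 2 ≤ |c| * (‖⟪W', ψ⟫_ℂ‖ + t * p * ‖ψ‖) := by gcongr
      _ = |c| * ‖⟪W', ψ⟫_ℂ‖ + t * (|c| * p * ‖ψ‖) := by ring
      _ ≤ _ := by gcongr
  have hlim : Filter.Tendsto (fun t : ℝ => 2 * ‖gψ‖ * p + t * (|c| * p * ‖ψ‖))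
      (nhdsWithin 0 (Set.Ioi 0)) (nhds (2 * ‖gψ‖ * p)) := by
    have : Continuous fun t : ℝ => 2 * ‖gψ‖ * p + t * (|c| * p * ‖ψ‖) := by fun_prop
    simpa using (this.tendsto 0).mono_left nhdsWithin_le_nhds
  exact ge_of_tendsto hlim (Filter.eventually_of_mem self_mem_nhdsWithin key)

/-! ### From vector states to mixed states -/

theorem integrable_bornMeasure_iff {φ : Hilb n} {f : Conf n → ℝ} :
    Integrable f (bornMeasure φ) ↔ Integrable fun x => f x * ‖φ x‖ ^ 2 := by
  rw [bornMeasure, integrable_withDensity_iff (measurable_enorm_sq φ)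
    (Filter.Eventually.of_forall fun x => by finiteness)]
  simp

theorem integral_bornMeasure {E : Type*} [NormedAddCommGroup E] [NormedSpace ℝ E] (φ : Hilb n)
    (f : Conf n → E) : ∫ x, f x ∂bornMeasure φ = ∫ x, (‖φ x‖ ^ 2) • f x := by
  rw [bornMeasure, integral_withDensity_eq_integral_toReal_smul (measurable_enorm_sq φ)
    (Filter.Eventually.of_forall fun x => by finiteness)]
  simp

theorem integrable_and_hasSum_integral_bornMeasure {ι : Type*} {φ : ι → Hilb n}
    {f : Conf n → ℝ} (hf : Integrable f (Measure.sum fun k => bornMeasure (φ k))) :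
    (∀ k, Integrable fun x => f x * ‖φ k x‖ ^ 2) ∧
      HasSum (fun k => ∫ x, f x * ‖φ k x‖ ^ 2)
        (∫ x, f x ∂Measure.sum fun k => bornMeasure (φ k)) := by
  refine ⟨fun k => integrable_bornMeasure_iff.1 (hf.mono_measure (Measure.le_sum _ k)), ?_⟩
  refine (hasSum_integral_measure hf).congr_fun fun k => ?_
  simp only [integral_bornMeasure, smul_eq_mul, mul_comm]

theorem memLp_id_of_lintegral {μ : Measure (Conf n)} (h : ∫⁻ x, ‖x‖ₑ ^ 2 ∂μ < ∞) :
    MemLp id 2 μ := by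
  refine ⟨aestronglyMeasurable_id, ?_⟩
  rw [eLpNorm_lt_top_iff_lintegral_rpow_enorm_lt_top two_ne_zero ENNReal.ofNat_ne_top]
  simpa using h

theorem memLp_inner_of_memLp_id {μ : Measure (Conf n)} (h : MemLp id 2 μ) (u : Conf n) :
    MemLp (fun x => ⟪u, x⟫_ℝ) 2 μ :=
  h.const_inner u

theorem variance_id_map_inner (μ : Measure (Conf n)) (u : Conf n) :
    ProbabilityTheory.variance id (μ.map fun x => ⟪u, x⟫_ℝ) =
      ∫ x, (⟪u, x⟫_ℝ - ∫ y, ⟪u, y⟫_ℝ ∂μ) ^ 2 ∂μ := by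
  rw [ProbabilityTheory.variance_map aemeasurable_id (by fun_prop), Function.id_comp,
    ProbabilityTheory.variance_eq_integral (by fun_prop)]

/-- A summed Cauchy-Schwarz inequality. -/
theorem sq_le_four_mul_of_hasSum {ι : Type*} {V W m : ι → ℝ} {v w c : ℝ} (hV : ∀ k, 0 ≤ V k)
    (hW : ∀ k, 0 ≤ W k) (hm : HasSum m 1) (hv : HasSum V v) (hw : HasSum W w) (hc : 0 ≤ c)
    (h : ∀ k, c * m k ≤ 2 * √(V k) * √(W k)) : c ^ 2 ≤ 4 * (v * w) := by
  -- For `s ≥ 0` each summand is nonnegative, since `(s√V - √W)² ≥ 0` bounds the cross term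
  -- `2s√V√W`, which dominates `s c m`. For `s < 0` all three terms are nonnegative. The claim is
  -- then the sign of the discriminant.
  have key : ∀ s : ℝ, 0 ≤ v * (s * s) + -c * s + w := by
    intro s
    rcases lt_or_ge s 0 with hs | hs
    · have e1 := hv.nonneg hV
      have e2 := hw.nonneg hW
      have e3 : 0 ≤ -c * s := mul_nonneg_of_nonpos_of_nonpos (neg_nonpos.2 hc) hs.le
      have e4 := mul_nonneg e1 (mul_self_nonneg s)
      linarith
    have hsum := ((hv.mul_right (s * s)).add (hm.mul_left (-c * s))).add hw
    rw [mul_one] at hsum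
    refine hsum.nonneg fun k => ?_
    have e1 := sq_nonneg (s * √(V k) - √(W k))
    have e2 := mul_le_mul_of_nonneg_right (h k) hs
    rw [sub_sq, mul_pow, Real.sq_sqrt (hV k), Real.sq_sqrt (hW k)] at e1
    linarith
  have hd := discrim_le_zero key
  rw [discrim, neg_sq] at hd
  linarith

/-- The uncertainty relation for `Q_u` and `P_v` in a state with finite second moments. -/
theorem uncertainty (hbar : ℝ) (ρ : State (Hilb n)) (hρ : FiniteSecondMoments hbar ρ)
    (u v : Conf n) :
    (hbar / 2 * ⟪u, v⟫_ℝ) ^ 2 ≤ varianceQAlong u ρ * variancePAlong hbar v ρ := by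
  have hm := measurable_momentum_scale (n := n) hbar
  have hQ := memLp_inner_of_memLp_id (memLp_id_of_lintegral hρ.1) u
  have hP := memLp_inner_of_memLp_id (memLp_id_of_lintegral hρ.2) v
  rw [varianceQAlong, positionPVMAlong, PVM.law_map, variance_id_map_inner, variancePAlong,
    momentumPVMAlong, PVM.law_map, variance_id_map_inner]
  -- The vector inequality holds for any centring, so the means of `ρ` serve for every component `√ρ
  -- eₖ`, whatever its own mean is.
  generalize ∫ x, ⟪u, x⟫_ℝ ∂(positionPVM n).law ρ = a
  generalize ∫ x, ⟪v, x⟫_ℝ ∂(momentumPVM n hbar).law ρ = b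
  have hQ2 : Integrable (fun x => (⟪u, x⟫_ℝ - a) ^ 2) ((positionPVM n).law ρ) :=
    (hQ.sub (memLp_const a)).integrable_sq
  have hP2 : Integrable (fun x => (⟪v, x⟫_ℝ - b) ^ 2) ((momentumPVM n hbar).law ρ) :=
    (hP.sub (memLp_const b)).integrable_sq
  -- Integrating the constant `1` yields `∑ₖ ‖√ρ eₖ‖² = 1`, the weights for the summation.
  have h1 : Integrable (fun _ => (1 : ℝ)) ((positionPVM n).law ρ) := integrable_const 1
  have i1 : ∫ _, (1 : ℝ) ∂((positionPVM n).law ρ) = 1 := by simp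
  rw [position_law_eq] at hQ2 h1 i1 ⊢
  rw [momentum_law_eq] at hP2 ⊢
  rw [integral_map hm.aemeasurable hP2.aestronglyMeasurable]
  rw [integrable_map_measure hP2.aestronglyMeasurable hm.aemeasurable] at hP2
  obtain ⟨intQ, sumQ⟩ := integrable_and_hasSum_integral_bornMeasure hQ2
  obtain ⟨intP, sumP⟩ := integrable_and_hasSum_integral_bornMeasure hP2
  obtain ⟨-, sum1⟩ := integrable_and_hasSum_integral_bornMeasure h1
  rw [i1] at sum1
  simp only [one_mul, ← norm_sq_eq_integral] at sum1
  have h := sq_le_four_mul_of_hasSum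
    (fun k => integral_nonneg fun x => mul_nonneg (sq_nonneg _) (sq_nonneg _))
    (fun k => integral_nonneg fun x => mul_nonneg (sq_nonneg _) (sq_nonneg _)) sum1 sumQ sumP
    (abs_nonneg (hbar * ⟪u, v⟫_ℝ))
    fun k => uncertainty_vector hbar u v a b _ (intQ k) (intP k)
  rw [sq_abs] at h
  simp only [Function.comp_apply] at h
  linear_combination h / 4

end Uncertainty

/-! ### Gaussian pure states -/

section Gaussian

variable {n : ℕ}

/-- The substitution `x = Λy` reduces to the standard Gaussian. The constant appears as `c²` because
`c` will be the amplitude of a wave function. -/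
theorem integral_gaussian_comp_symm (Λ : Conf n ≃L[ℝ] Conf n)
    (hΛ : ∀ x y, ⟪Λ x, y⟫_ℝ = ⟪x, Λ y⟫_ℝ) :
    ∃ c : ℝ, 0 < c ∧ ∀ t : Conf n,
      ∫ x, ((c ^ 2 * Real.exp (-(‖Λ.symm x‖ ^ 2 / 2)) : ℝ) : ℂ) *
        Complex.exp (⟪x, t⟫_ℝ * Complex.I) = Complex.exp (-(‖Λ t‖ ^ 2 / 2 : ℝ)) := by
  set f : Conf n →ₗ[ℝ] Conf n := Λ.toLinearEquiv.toLinearMap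
  have hdet : LinearMap.det f ≠ 0 := (LinearEquiv.isUnit_det' Λ.toLinearEquiv).ne_zero
  set d : ℝ := |(LinearMap.det f)⁻¹|
  have dpos : 0 < d := abs_pos.2 (inv_ne_zero hdet)
  set κ : ℝ := (2 * Real.pi) ^ ((n : ℝ) / 2) with hκ
  have κpos : 0 < κ := by positivity
  refine ⟨√(d / κ), Real.sqrt_pos.2 (by positivity), fun t => ?_⟩
  rw [Real.sq_sqrt (by positivity)]
  have hmap := Measure.map_linearMap_addHaar_eq_smul_addHaar (volume : Measure (Conf n)) hdet
  have hchange : ∀ g : Conf n → ℂ, ∫ y, g (Λ y) = d * ∫ x, g x := fun g => by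
    have h1 : ∫ x, g x ∂(Measure.map f volume) = ∫ y, g (Λ y) :=
      (Λ.toHomeomorph.measurableEmbedding.integral_map g)
    rw [← h1, hmap, integral_smul_measure, ENNReal.toReal_ofReal (abs_nonneg _), Complex.real_smul]
  have h := GaussianFourier.integral_cexp_neg_mul_sq_norm_add (V := Conf n) (b := 1 / 2)
    (by norm_num) Complex.I (Λ t)
  have h2 := hchange fun x => Complex.exp (-(1 / 2) * ‖Λ.symm x‖ ^ 2 + Complex.I * ⟪x, t⟫_ℝ)
  have h3 : ∫ y, Complex.exp (-(1 / 2) * ‖Λ.symm (Λ y)‖ ^ 2 + Complex.I * ⟪Λ y, t⟫_ℝ) =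
      κ * Complex.exp (-(‖Λ t‖ ^ 2 / 2 : ℝ)) := by
    simp only [ContinuousLinearEquiv.symm_apply_apply, hΛ]
    simp only [real_inner_comm _ (Λ t)] at h
    rw [h, hκ, Complex.ofReal_cpow (by positivity), finrank_euclideanSpace, Fintype.card_fin]
    congr 2
    · push_cast
      ring
    · push_cast
      ring
    · rw [Complex.I_sq]
      push_cast
      ring
  have h4 : (κ : ℂ) ≠ 0 := by exact_mod_cast κpos.ne'
  have h5 : ∀ x : Conf n, ((d / κ * Real.exp (-(‖Λ.symm x‖ ^ 2 / 2)) : ℝ) : ℂ) *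
        Complex.exp (⟪x, t⟫_ℝ * Complex.I) = (d / κ : ℂ) *
      Complex.exp (-(1 / 2) * ‖Λ.symm x‖ ^ 2 + Complex.I * ⟪x, t⟫_ℝ) := fun x => by
    push_cast
    rw [mul_assoc, ← Complex.exp_add]
    congr 2
    ring
  simp only [h5]
  rw [integral_const_mul, div_mul_eq_mul_div, ← h2, h3, mul_div_cancel_left₀ _ h4]

/-- The chirped Gaussian wave function with position covariance `Λ²`. -/
def gaussianWave (hbar c : ℝ) (Λ : Conf n ≃L[ℝ] Conf n) (R : Conf n →L[ℝ] Conf n)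
    (x : Conf n) : ℂ :=
  c * Complex.exp (-(‖Λ.symm x‖ ^ 2 / 4 : ℝ) +
    Complex.I * (⟪Λ.symm x, R (Λ.symm x)⟫_ℝ / (2 * hbar) : ℝ))

theorem continuous_gaussianWave (hbar c : ℝ) (Λ : Conf n ≃L[ℝ] Conf n)
    (R : Conf n →L[ℝ] Conf n) : Continuous (gaussianWave hbar c Λ R) := by
  unfold gaussianWave
  fun_prop

theorem norm_gaussianWave_sq (hbar c : ℝ) (Λ : Conf n ≃L[ℝ] Conf n)
    (R : Conf n →L[ℝ] Conf n) (x : Conf n) :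
    ‖gaussianWave hbar c Λ R x‖ ^ 2 = c ^ 2 * Real.exp (-(‖Λ.symm x‖ ^ 2 / 2)) := by
  rw [gaussianWave, norm_mul, Complex.norm_exp, Complex.norm_real, mul_pow, Real.norm_eq_abs,
    sq_abs, ← Real.exp_nat_mul, Complex.add_re, Complex.neg_re, Complex.ofReal_re,
    Complex.I_mul_re, Complex.ofReal_im]
  congr 2
  push_cast
  ring

/-- With arguments symmetric about `y`, the cross terms of the modulus cancel, while in the phase
only the cross term survives. The product is therefore a Gaussian in `s` times a Gaussian in `y`
with a phase linear in `y`, ready for a Fourier integral. -/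
theorem gaussianWave_add_mul_conj (hbar c : ℝ) (hbar_ne : hbar ≠ 0) (Λ : Conf n ≃L[ℝ] Conf n)
    (hΛ : ∀ x y, ⟪Λ x, y⟫_ℝ = ⟪x, Λ y⟫_ℝ) (R : Conf n →L[ℝ] Conf n)
    (hR : ∀ x y, ⟪R x, y⟫_ℝ = ⟪x, R y⟫_ℝ) (s y : Conf n) :
    gaussianWave hbar c Λ R (y + (hbar / 2) • s) *
        starRingEnd ℂ (gaussianWave hbar c Λ R (y - (hbar / 2) • s)) =
      Complex.exp (-(hbar ^ 2 / 4 * ‖Λ.symm s‖ ^ 2 / 2 : ℝ)) *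
        (((c ^ 2 * Real.exp (-(‖Λ.symm y‖ ^ 2 / 2)) : ℝ) : ℂ) *
          Complex.exp (⟪y, Λ.symm (R (Λ.symm s))⟫_ℝ * Complex.I)) := by
  have hK : ∀ x y, ⟪Λ.symm x, y⟫_ℝ = ⟪x, Λ.symm y⟫_ℝ := fun x y => by
    conv_lhs => rw [← Λ.apply_symm_apply y, ← hΛ, Λ.apply_symm_apply]
  rw [← hK]
  simp only [gaussianWave, map_add, map_sub, map_smul, map_mul, ← Complex.exp_conj,
    Complex.conj_ofReal, Complex.conj_I, map_neg]
  set Y := Λ.symm y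
  set S := Λ.symm s
  have e1 : ‖Y + (hbar / 2) • S‖ ^ 2 = ‖Y‖ ^ 2 + hbar * ⟪Y, S⟫_ℝ + hbar ^ 2 / 4 * ‖S‖ ^ 2 := by
    rw [norm_add_sq_real, inner_smul_right, norm_smul, mul_pow, Real.norm_eq_abs, sq_abs]; ring
  have e2 : ‖Y - (hbar / 2) • S‖ ^ 2 = ‖Y‖ ^ 2 - hbar * ⟪Y, S⟫_ℝ + hbar ^ 2 / 4 * ‖S‖ ^ 2 := by
    rw [norm_sub_sq_real, inner_smul_right, norm_smul, mul_pow, Real.norm_eq_abs, sq_abs]; ring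
  have e3 : ⟪S, R Y⟫_ℝ = ⟪Y, R S⟫_ℝ := by rw [← hR, real_inner_comm]
  have e4 : ⟪Y + (hbar / 2) • S, R Y + (hbar / 2) • R S⟫_ℝ =
      ⟪Y, R Y⟫_ℝ + hbar * ⟪Y, R S⟫_ℝ + hbar ^ 2 / 4 * ⟪S, R S⟫_ℝ := by
    simp only [inner_add_left, inner_add_right, real_inner_smul_left, real_inner_smul_right, e3]
    ring
  have e5 : ⟪Y - (hbar / 2) • S, R Y - (hbar / 2) • R S⟫_ℝ =
      ⟪Y, R Y⟫_ℝ - hbar * ⟪Y, R S⟫_ℝ + hbar ^ 2 / 4 * ⟪S, R S⟫_ℝ := by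
    simp only [inner_sub_left, inner_sub_right, real_inner_smul_left, real_inner_smul_right, e3]
    ring
  rw [e1, e2, e4, e5]
  push_cast
  have hc : (hbar : ℂ) ≠ 0 := by exact_mod_cast hbar_ne
  have e6 : ∀ a b p q r : ℂ, p + q = a + b + r →
      c * Complex.exp p * (c * Complex.exp q) =
        Complex.exp a * (c ^ 2 * Complex.exp b * Complex.exp r) := by
    intro a b p q r h
    have := congrArg Complex.exp h
    rw [Complex.exp_add, Complex.exp_add, Complex.exp_add] at this
    linear_combination (c : ℂ) ^ 2 * this
  apply e6
  field_simp
  ring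

theorem charFun_bornMeasure (φ : Hilb n) (t : Conf n) :
    charFun (bornMeasure φ) t =
      ∫ x, ((‖φ x‖ ^ 2 : ℝ) : ℂ) * Complex.exp (⟪x, t⟫_ℝ * Complex.I) := by
  rw [charFun_apply, integral_bornMeasure]
  rfl

/-- The characteristic function of the momentum distribution is an autocorrelation. -/
theorem charFun_map_bornMeasure_fourier (hbar : ℝ) (ψ : Hilb n) (s : Conf n) :
    charFun ((bornMeasure (fourierL2 n ψ)).map fun ξ => (2 * Real.pi * hbar) • ξ) s =
      ⟪ψ, translation (-(hbar • s)) ψ⟫_ℂ := by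
  rw [← (fourierL2 n).inner_map_map, fourier_translation, charFun_apply,
    integral_map (measurable_momentum_scale hbar).aemeasurable (by fun_prop), integral_bornMeasure,
    L2.inner_def]
  refine integral_congr_ae ?_
  filter_upwards [phaseMul_ae (-(hbar • s)) (fourierL2 n ψ)] with ξ h
  rw [h, RCLike.inner_apply, mul_assoc (Complex.exp _), Complex.mul_conj, Complex.normSq_eq_norm_sq,
    Complex.real_smul, mul_comm, inner_neg_left, real_inner_smul_left, real_inner_smul_left,
    real_inner_comm]
  congr 2
  push_cast
  ring

/-- The phase given by `R` leaves the position law untouched and only enlarges the momentum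
covariance, from the minimal `(ħ²/4)Λ⁻²` to `Λ⁻¹(ħ²/4 + R²)Λ⁻¹`. -/
theorem exists_gaussian_vector (hbar : ℝ) (hbar_ne : hbar ≠ 0) (Λ : Conf n ≃L[ℝ] Conf n)
    (hΛ : ∀ x y, ⟪Λ x, y⟫_ℝ = ⟪x, Λ y⟫_ℝ) (R : Conf n →L[ℝ] Conf n)
    (hR : ∀ x y, ⟪R x, y⟫_ℝ = ⟪x, R y⟫_ℝ) :
    ∃ ψ : Hilb n, ‖ψ‖ = 1 ∧
      (∀ t, charFun (bornMeasure ψ) t = Complex.exp (-(‖Λ t‖ ^ 2 / 2 : ℝ))) ∧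
      ∀ s, charFun ((bornMeasure (fourierL2 n ψ)).map fun ξ => (2 * Real.pi * hbar) • ξ) s =
        Complex.exp
          (-((hbar ^ 2 / 4 * ‖Λ.symm s‖ ^ 2 + ‖R (Λ.symm s)‖ ^ 2) / 2 : ℝ)) := by
  obtain ⟨c, -, hG⟩ := integral_gaussian_comp_symm Λ hΛ
  set w := gaussianWave hbar c Λ R
  have hint1 : ∫ x, ‖w x‖ ^ 2 = 1 := by
    have h := hG 0
    simp only [inner_zero_right, Complex.ofReal_zero, zero_mul, Complex.exp_zero, mul_one, map_zero,
      norm_zero] at h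
    rw [integral_complex_ofReal] at h
    simp only [w, norm_gaussianWave_sq]
    have h' : ((∫ x, c ^ 2 * Real.exp (-(‖Λ.symm x‖ ^ 2 / 2)) : ℝ) : ℂ) = (1 : ℝ) := by
      rw [h]; simp
    exact_mod_cast h'
  -- A nonintegrable function has integral `0`, so the value `1` already forces square
  -- integrability.
  have hmem : MemLp w 2 volume :=
    (memLp_two_iff_integrable_sq_norm
      (continuous_gaussianWave hbar c Λ R).aestronglyMeasurable).2
      (Integrable.of_integral_ne_zero (by rw [hint1]; exact one_ne_zero))
  have hψ : hmem.toLp w =ᵐ[volume] w := hmem.coeFn_toLp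
  refine ⟨hmem.toLp w, ?_, fun t => ?_, fun s => ?_⟩
  · have h : ‖hmem.toLp w‖ ^ 2 = 1 := by
      rw [norm_sq_eq_integral, ← hint1]
      refine integral_congr_ae ?_
      filter_upwards [hψ] with x h
      rw [h]
    exact (pow_eq_one_iff_of_nonneg (norm_nonneg _) two_ne_zero).1 h
  · rw [charFun_bornMeasure, ← hG t]
    refine integral_congr_ae ?_
    filter_upwards [hψ] with x h
    rw [h, norm_gaussianWave_sq]
  · rw [charFun_map_bornMeasure_fourier, L2.inner_def]
    have h1 : ∫ x, ⟪hmem.toLp w x, translation (-(hbar • s)) (hmem.toLp w) x⟫_ℂ =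
        ∫ x, w (x + hbar • s) * starRingEnd ℂ (w x) := by
      refine integral_congr_ae ?_
      filter_upwards [hψ, translation_ae (-(hbar • s)) (hmem.toLp w),
        (measurePreserving_sub_right volume (-(hbar • s))).quasiMeasurePreserving.ae hψ]
        with x h2 h3 h4
      rw [h2, h3, h4, RCLike.inner_apply, sub_neg_eq_add]
    -- Recentring by half the shift makes the two arguments symmetric about the integration
    -- variable.
    rw [h1, ← integral_sub_right_eq_self _ ((hbar / 2) • s)]
    have h2 : ∀ y : Conf n, y - (hbar / 2) • s + hbar • s = y + (hbar / 2) • s := fun y => by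
      module
    simp only [h2, w, gaussianWave_add_mul_conj hbar c hbar_ne Λ hΛ R hR]
    rw [integral_const_mul, hG, Λ.apply_symm_apply, ← Complex.exp_add]
    congr 1
    push_cast
    ring

end Gaussian

/-! ### Variance matrices -/

section VarianceMatrices

open Matrix ProbabilityTheory

variable {n : ℕ}

theorem variance_inner_eq_dotProduct {μ : Measure (Conf n)} [IsFiniteMeasure μ]
    (h : MemLp id 2 μ) (u : Conf n) :
    variance id (μ.map fun x => ⟪u, x⟫_ℝ) =
      u ⬝ᵥ (Matrix.of fun i j => cov[fun x => x i, fun x => x j; μ]) *ᵥ u := by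
  have hc : ∀ i, MemLp (fun x : Conf n => x i) 2 μ := fun i => by
    simpa only [EuclideanSpace.inner_single_left, map_one, one_mul] using
      memLp_inner_of_memLp_id h (EuclideanSpace.single i (1 : ℝ))
  have hu : (fun x : Conf n => ⟪u, x⟫_ℝ) = fun x => ∑ i, u i * x i := by
    ext x
    simp [PiLp.inner_apply, mul_comm]
  rw [variance_map aemeasurable_id (by fun_prop), Function.id_comp,
    ← covariance_self (by fun_prop), hu, covariance_fun_sum_fun_sum
      (fun i => (hc i).const_mul (u i)) (fun i => (hc i).const_mul (u i))]
  simp only [covariance_const_mul_left, covariance_const_mul_right, dotProduct, mulVec, of_apply,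
    Finset.mul_sum]
  refine Finset.sum_congr rfl fun i _ => Finset.sum_congr rfl fun j _ => ?_
  ring

theorem varQ_eq_cov (ρ : State (Hilb n)) :
    varQ ρ = Matrix.of fun i j => cov[fun x => x i, fun x => x j; (positionPVM n).law ρ] := rfl

theorem varP_eq_cov (hbar : ℝ) (ρ : State (Hilb n)) : varP hbar ρ =
    Matrix.of fun i j => cov[fun x => x i, fun x => x j; (momentumPVM n hbar).law ρ] := rfl

theorem varianceQAlong_eq {hbar : ℝ} {ρ : State (Hilb n)} (hρ : FiniteSecondMoments hbar ρ)
    (u : Conf n) : varianceQAlong u ρ = u ⬝ᵥ varQ ρ *ᵥ u := by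
  rw [varianceQAlong, positionPVMAlong, PVM.law_map,
    variance_inner_eq_dotProduct (memLp_id_of_lintegral hρ.1), varQ_eq_cov]

theorem variancePAlong_eq {hbar : ℝ} {ρ : State (Hilb n)} (hρ : FiniteSecondMoments hbar ρ)
    (v : Conf n) : variancePAlong hbar v ρ = v ⬝ᵥ varP hbar ρ *ᵥ v := by
  rw [variancePAlong, momentumPVMAlong, PVM.law_map,
    variance_inner_eq_dotProduct (memLp_id_of_lintegral hρ.2), varP_eq_cov]

/-- The uncertainty relation between the variance matrices of position and momentum. -/
theorem posSemidef_varP_sub {hbar : ℝ} {ρ : State (Hilb n)} (hρ : FiniteSecondMoments hbar ρ)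
    (hA : (varQ ρ).PosDef) (hB : (varP hbar ρ).PosDef) :
    (varP hbar ρ - (hbar ^ 2 / 4) • (varQ ρ)⁻¹).PosSemidef := by
  have hAi := hA.inv
  refine .of_dotProduct_mulVec_nonneg (hB.1.sub (hAi.1.smul (IsSelfAdjoint.all _))) fun y => ?_
  rw [star_trivial]
  by_cases hy : y = 0
  · simp [hy]
  have hpos : 0 < y ⬝ᵥ (varQ ρ)⁻¹ *ᵥ y := by simpa using hAi.dotProduct_mulVec_pos hy
  -- For this choice both `u·v` and the variance of `Q_u` equal `y·A⁻¹y`, so one positive factor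
  -- cancels. It is the direction optimising the scalar inequality for given `v = y`.
  have h := uncertainty hbar ρ hρ (WithLp.toLp 2 ((varQ ρ)⁻¹ *ᵥ y)) (WithLp.toLp 2 y)
  rw [varianceQAlong_eq hρ, variancePAlong_eq hρ] at h
  have e1 : ⟪(WithLp.toLp 2 ((varQ ρ)⁻¹ *ᵥ y) : Conf n), WithLp.toLp 2 y⟫_ℝ =
      y ⬝ᵥ (varQ ρ)⁻¹ *ᵥ y := by
    simp [PiLp.inner_apply, dotProduct]
  have e2 : ((varQ ρ)⁻¹ *ᵥ y) ⬝ᵥ varQ ρ *ᵥ ((varQ ρ)⁻¹ *ᵥ y) = y ⬝ᵥ (varQ ρ)⁻¹ *ᵥ y := by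
    rw [mulVec_mulVec, Matrix.mul_nonsing_inv _ ((isUnit_iff_isUnit_det _).1 hA.isUnit),
      one_mulVec, dotProduct_comm]
  rw [e1] at h
  simp only [e2] at h
  rw [sub_mulVec, dotProduct_sub, smul_mulVec, dotProduct_smul, smul_eq_mul, sub_nonneg]
  refine le_of_mul_le_mul_left ?_ hpos
  linear_combination h

/-! ### Realization of prescribed variances by Gaussian states -/

theorem norm_toEuclideanCLM_sq (M : Matrix (Fin n) (Fin n) ℝ) (x : Conf n) :
    ‖toEuclideanCLM (𝕜 := ℝ) M x‖ ^ 2 = x ⬝ᵥ (Mᵀ * M) *ᵥ x := by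
  rw [← real_inner_self_eq_norm_sq, inner_toEuclideanCLM, ofLp_toEuclideanCLM,
    ← mulVec_mulVec, dotProduct_mulVec, dotProduct_mulVec, vecMul_transpose, ← dotProduct_mulVec]

theorem inner_toEuclideanCLM_comm {M : Matrix (Fin n) (Fin n) ℝ} (hM : Mᵀ = M) (x y : Conf n) :
    ⟪toEuclideanCLM (𝕜 := ℝ) M x, y⟫_ℝ = ⟪x, toEuclideanCLM (𝕜 := ℝ) M y⟫_ℝ := by
  rw [real_inner_comm, inner_toEuclideanCLM, inner_toEuclideanCLM, dotProduct_mulVec,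
    ← mulVec_transpose, hM, dotProduct_comm]

open scoped MatrixOrder in
theorem exists_symm_sqrt {A : Matrix (Fin n) (Fin n) ℝ} (hA : A.PosSemidef) :
    ∃ L : Matrix (Fin n) (Fin n) ℝ, Lᵀ = L ∧ L * L = A :=
  ⟨CFC.sqrt A, by simpa using (CFC.sqrt_nonneg A).posSemidef.1.eq,
    CFC.sqrt_mul_sqrt_self A hA.nonneg⟩

/-- An invertible matrix as a continuous linear equivalence of Euclidean space. -/
def toEuclideanCLE (L : Matrix (Fin n) (Fin n) ℝ) (hL : IsUnit L.det) : Conf n ≃L[ℝ] Conf n :=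
  ContinuousLinearEquiv.equivOfInverse (toEuclideanCLM (𝕜 := ℝ) L) (toEuclideanCLM (𝕜 := ℝ) L⁻¹)
    (fun x => by
      have h := DFunLike.congr_fun (map_mul (toEuclideanCLM (n := Fin n) (𝕜 := ℝ)) L⁻¹ L) x
      rw [Matrix.nonsing_inv_mul _ hL, map_one] at h
      exact h.symm)
    (fun x => by
      have h := DFunLike.congr_fun (map_mul (toEuclideanCLM (n := Fin n) (𝕜 := ℝ)) L L⁻¹) x
      rw [Matrix.mul_nonsing_inv _ hL, map_one] at h
      exact h.symm)

theorem lintegral_enorm_sq_lt_top {μ : Measure (Conf n)} (h : MemLp id 2 μ) :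
    ∫⁻ x, ‖x‖ₑ ^ 2 ∂μ < ∞ := by
  simpa using (eLpNorm_lt_top_iff_lintegral_rpow_enorm_lt_top two_ne_zero
    ENNReal.ofNat_ne_top).1 h.2

/-- Gaussian pure states realize all variance matrices allowed by the uncertainty relation. -/
theorem exists_state_of_posSemidef {hbar : ℝ} (hbar_ne : hbar ≠ 0)
    {A B : Matrix (Fin n) (Fin n) ℝ} (hA : A.PosDef) (hB : B.PosSemidef)
    (h : (B - (hbar ^ 2 / 4) • A⁻¹).PosSemidef) :
    ∃ ρ : State (Hilb n), FiniteSecondMoments hbar ρ ∧ varQ ρ = A ∧ varP hbar ρ = B := by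
  obtain ⟨L, hLt, hL⟩ := exists_symm_sqrt hA.posSemidef
  have hdet : IsUnit L.det := by
    have := (isUnit_iff_isUnit_det _).1 hA.isUnit
    rw [← hL, det_mul] at this
    exact isUnit_of_mul_isUnit_left this
  have hLit : L⁻¹ᵀ = L⁻¹ := by rw [transpose_nonsing_inv, hLt]
  -- Chosen so that `L⁻¹R²L⁻¹` is exactly the excess of `B` over `(ħ²/4)A⁻¹`; this is where the
  -- hypothesis `h` enters.
  obtain ⟨R, hRt, hR⟩ := exists_symm_sqrt (A := L * (B - (hbar ^ 2 / 4) • A⁻¹) * L)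
    (by simpa [conjTranspose_eq_transpose_of_trivial, hLt] using h.mul_mul_conjTranspose_same L)
  obtain ⟨ψ, hψ, hQ, hP⟩ := exists_gaussian_vector hbar hbar_ne (toEuclideanCLE L hdet)
    (inner_toEuclideanCLM_comm hLt) (toEuclideanCLM (𝕜 := ℝ) R) (inner_toEuclideanCLM_comm hRt)
  have lawQ : (positionPVM n).law (pureState ψ hψ) = multivariateGaussian 0 A := by
    refine Measure.ext_of_charFun (funext fun t => ?_)
    rw [position_law_pureState, hQ, charFun_multivariateGaussian hA.posSemidef]
    have e : ‖toEuclideanCLE L hdet t‖ ^ 2 = t ⬝ᵥ A *ᵥ t := by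
      have e0 := norm_toEuclideanCLM_sq L t
      rwa [hLt, hL] at e0
    rw [e, inner_zero_right]
    congr 1
    push_cast
    ring
  have lawP : (momentumPVM n hbar).law (pureState ψ hψ) = multivariateGaussian 0 B := by
    refine Measure.ext_of_charFun (funext fun s => ?_)
    rw [momentum_law_pureState, hP, charFun_multivariateGaussian hB]
    have e1 : ‖(toEuclideanCLE L hdet).symm s‖ ^ 2 = s ⬝ᵥ A⁻¹ *ᵥ s := by
      have e0 := norm_toEuclideanCLM_sq L⁻¹ s
      rwa [hLit, ← Matrix.mul_inv_rev, hL] at e0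
    have e2 : ‖toEuclideanCLM (𝕜 := ℝ) R ((toEuclideanCLE L hdet).symm s)‖ ^ 2 =
        s ⬝ᵥ (B - (hbar ^ 2 / 4) • A⁻¹) *ᵥ s := by
      have e3 := norm_toEuclideanCLM_sq (R * L⁻¹) s
      rw [map_mul, transpose_mul, hRt, hLit, Matrix.mul_assoc, ← Matrix.mul_assoc R, hR,
        Matrix.mul_assoc L, Matrix.mul_assoc L, Matrix.mul_assoc _ L,
        Matrix.mul_nonsing_inv _ hdet, Matrix.mul_one, ← Matrix.mul_assoc,
        Matrix.nonsing_inv_mul _ hdet, Matrix.one_mul] at e3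
      exact e3
    rw [e1, e2, inner_zero_right, sub_mulVec, dotProduct_sub, smul_mulVec, dotProduct_smul,
      smul_eq_mul]
    congr 1
    push_cast
    ring
  refine ⟨pureState ψ hψ, ⟨?_, ?_⟩, ?_, ?_⟩
  · rw [lawQ]
    exact lintegral_enorm_sq_lt_top IsGaussian.memLp_two_id
  · rw [lawP]
    exact lintegral_enorm_sq_lt_top IsGaussian.memLp_two_id
  · rw [varQ_eq_cov, lawQ]
    ext i j
    exact covariance_eval_multivariateGaussian hA.posSemidef i j
  · rw [varP_eq_cov, lawP]
    ext i j
    exact covariance_eval_multivariateGaussian hB i j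

/-- The projection term is degenerate only along `u`, and there the rank-one term is positive
because `w` is not orthogonal to `u`. -/
theorem posDef_smul_vecMulVec_add {u w : Fin n → ℝ} (hu : u ⬝ᵥ u = 1) (hw : w ⬝ᵥ u ≠ 0)
    {a m : ℝ} (ha : 0 < a) (hm : 0 < m) :
    (a • vecMulVec w w + m • (1 - vecMulVec u u)).PosDef := by
  refine .of_dotProduct_mulVec_pos ?_ fun x hx => ?_
  · ext i j
    simp [vecMulVec_apply, one_apply, eq_comm, mul_comm]
  have hxu : x ⬝ᵥ u = u ⬝ᵥ x := dotProduct_comm _ _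
  have hxw : x ⬝ᵥ w = w ⬝ᵥ x := dotProduct_comm _ _
  have e : star x ⬝ᵥ (a • vecMulVec w w + m • (1 - vecMulVec u u)) *ᵥ x =
      a * (w ⬝ᵥ x) ^ 2 + m * ((x - (u ⬝ᵥ x) • u) ⬝ᵥ (x - (u ⬝ᵥ x) • u)) := by
    simp only [star_trivial, add_mulVec, smul_mulVec, sub_mulVec, one_mulVec, vecMulVec_mulVec,
      dotProduct_add, dotProduct_smul, dotProduct_sub, sub_dotProduct, smul_dotProduct, smul_eq_mul,
      hu, hxu, hxw, op_smul_eq_smul]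
    ring
  rw [e]
  have hnn : ∀ y : Fin n → ℝ, 0 ≤ y ⬝ᵥ y := fun y => by simpa using dotProduct_star_self_nonneg y
  by_cases hy : x - (u ⬝ᵥ x) • u = 0
  · have hux : u ⬝ᵥ x ≠ 0 := fun h0 => hx (by simpa [h0] using hy)
    have hwx : w ⬝ᵥ x = (u ⬝ᵥ x) * (w ⬝ᵥ u) := by
      rw [sub_eq_zero] at hy
      conv_lhs => rw [hy]
      simp
    rw [hy, hwx]
    have := mul_ne_zero hux hw
    simp only [dotProduct_zero, mul_zero, add_zero]
    positivity
  · have h1 : 0 < (x - (u ⬝ᵥ x) • u) ⬝ᵥ (x - (u ⬝ᵥ x) • u) :=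
      (hnn _).lt_of_ne fun h0 => hy (dotProduct_self_eq_zero.1 h0.symm)
    positivity

/-- Here `w` is `A⁻¹v`. The momentum matrix `(ħ²/4)A⁻¹` has variance `(ħ²/4) v·w` along `v`, and
adding the missing nonnegative multiple of `vvᵀ` raises it to `cP`. -/
theorem exists_state_variance_along {hbar cP : ℝ} (hbar_ne : hbar ≠ 0)
    {A : Matrix (Fin n) (Fin n) ℝ} (hA : A.PosDef) (u v w : Conf n) (hv : v ⬝ᵥ v = 1)
    (hw : A *ᵥ w = v) (hle : hbar ^ 2 / 4 * (v ⬝ᵥ w) ≤ cP) :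
    ∃ ρ : State (Hilb n), FiniteSecondMoments hbar ρ ∧ varianceQAlong u ρ = u ⬝ᵥ A *ᵥ u ∧
      variancePAlong hbar v ρ = cP := by
  have hD : ((cP - hbar ^ 2 / 4 * (v ⬝ᵥ w)) • vecMulVec (v : Fin n → ℝ) v).PosSemidef :=
    (by simpa using posSemidef_vecMulVec_self_star (v : Fin n → ℝ) :
      (vecMulVec (v : Fin n → ℝ) v).PosSemidef).smul (sub_nonneg.2 hle)
  have hB := (hA.inv.posSemidef.smul (by positivity : 0 ≤ hbar ^ 2 / 4)).add hD
  obtain ⟨ρ, hρ, hQ, hP⟩ := exists_state_of_posSemidef hbar_ne hA hB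
    (by rwa [add_sub_cancel_left])
  have hAv : A⁻¹ *ᵥ v = w := by
    rw [← hw, mulVec_mulVec, nonsing_inv_mul _ ((isUnit_iff_isUnit_det _).1 hA.isUnit), one_mulVec]
  refine ⟨ρ, hρ, by rw [varianceQAlong_eq hρ, hQ], ?_⟩
  rw [variancePAlong_eq hρ, hP]
  simp only [add_mulVec, smul_mulVec, hAv, vecMulVec_mulVec, dotProduct_add, dotProduct_smul,
    smul_eq_mul, hv, op_smul_eq_smul]
  ring

theorem exists_state_of_le {hbar cQ cP : ℝ} (hbar_pos : 0 < hbar) {u v : Conf n}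
    (hu : ‖u‖ = 1) (hv : ‖v‖ = 1) (hQ : 0 < cQ) (hP : 0 < cP)
    (h : (hbar / 2 * ⟪u, v⟫_ℝ) ^ 2 ≤ cQ * cP) :
    ∃ ρ : State (Hilb n), FiniteSecondMoments hbar ρ ∧ varianceQAlong u ρ = cQ ∧
      variancePAlong hbar v ρ = cP := by
  have hdot : ∀ x y : Conf n, ⟪x, y⟫_ℝ = x ⬝ᵥ y := fun x y => by
    simp [PiLp.inner_apply, dotProduct, mul_comm]
  have hu1 : u ⬝ᵥ u = 1 := by rw [← hdot, real_inner_self_eq_norm_sq, hu, one_pow]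
  have hv1 : v ⬝ᵥ v = 1 := by rw [← hdot, real_inner_self_eq_norm_sq, hv, one_pow]
  rw [hdot] at h
  have hvu : v ⬝ᵥ u = u ⬝ᵥ v := dotProduct_comm _ _
  by_cases hc : u ⬝ᵥ v = 0
  -- Orthogonal directions decouple: with `A = cQ uuᵀ + m(1 - uuᵀ)`, `v` is an eigenvector with
  -- eigenvalue `m`, and this `m` gives `(ħ²/4) v·A⁻¹v = cP` exactly.
  · have hm : 0 < hbar ^ 2 / (4 * cP) := by positivity
    have hA := posDef_smul_vecMulVec_add hu1 (by rw [hu1]; exact one_ne_zero) hQ hm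
    obtain ⟨ρ, h1, h2, h3⟩ := exists_state_variance_along hbar_pos.ne' (cP := cP) hA u v
      ((hbar ^ 2 / (4 * cP))⁻¹ • v) hv1 (by
        simp only [WithLp.ofLp_smul, mulVec_smul, add_mulVec, smul_mulVec, sub_mulVec, one_mulVec,
          vecMulVec_mulVec, hc, op_smul_eq_smul, zero_smul, smul_zero, zero_add, sub_zero]
        rw [smul_smul, inv_mul_cancel₀ hm.ne', one_smul]) (by
        simp only [WithLp.ofLp_smul, dotProduct_smul, hv1, smul_eq_mul]
        refine le_of_eq ?_
        field_simp)
    refine ⟨ρ, h1, ?_, h3⟩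
    rw [h2]
    simp only [add_mulVec, smul_mulVec, sub_mulVec, one_mulVec, vecMulVec_mulVec, dotProduct_add,
      dotProduct_sub, dotProduct_smul, smul_eq_mul, op_smul_eq_smul, hu1]
    ring
  -- The rank-one term along `v` gives `Au = (cQ/(u·v)) v` and `u·Au = cQ`, hence `v·A⁻¹v =
  -- (u·v)²/cQ`, the smallest value compatible with `u·Au = cQ`. The coefficient `1` of the
  -- projection is arbitrary, since that term annihilates `u`.
  · have hA := posDef_smul_vecMulVec_add hu1 (by rwa [hvu] : v ⬝ᵥ u ≠ 0)
      (by positivity : 0 < cQ / (u ⬝ᵥ v) ^ 2) one_pos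
    obtain ⟨ρ, h1, h2, h3⟩ := exists_state_variance_along hbar_pos.ne' (cP := cP) hA u v
      (((u ⬝ᵥ v) / cQ) • u) hv1 (by
        simp only [WithLp.ofLp_smul, mulVec_smul, add_mulVec, smul_mulVec, sub_mulVec, one_mulVec,
          vecMulVec_mulVec, hvu, hu1, op_smul_eq_smul, one_smul, sub_self, add_zero]
        rw [smul_smul, smul_smul]
        convert one_smul ℝ (v : Fin n → ℝ)
        field_simp) (by
        simp only [WithLp.ofLp_smul, dotProduct_smul, hvu, smul_eq_mul]
        rw [← mul_le_mul_iff_right₀ hQ]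
        refine le_trans (le_of_eq ?_) h
        field_simp
        ring)
    refine ⟨ρ, h1, ?_, h3⟩
    rw [h2]
    simp only [add_mulVec, smul_mulVec, sub_mulVec, one_mulVec, vecMulVec_mulVec, dotProduct_add,
      dotProduct_sub, dotProduct_smul, smul_eq_mul, op_smul_eq_smul, hu1, hvu]
    field_simp
    ring

end VarianceMatrices

end QVar

end

theorem mainTheorem8 (n : ℕ) (hbar : ℝ) (hbar_pos : 0 < hbar) :
    (∀ A B : Matrix (Fin n) (Fin n) ℝ, A.PosDef → B.PosDef →
      ((∃ ρ : QVar.State (QVar.Hilb n), QVar.FiniteSecondMoments hbar ρ ∧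
          (QVar.quantumVarianceMatrix hbar ρ).toBlocks₁₁ = A ∧
          (QVar.quantumVarianceMatrix hbar ρ).toBlocks₂₂ = B) ↔
        (B - (hbar ^ 2 / 4) • A⁻¹).PosSemidef)) ∧
    (∀ (u v : EuclideanSpace ℝ (Fin n)) (α : ℝ), ‖u‖ = 1 → ‖v‖ = 1 → ⟪u, v⟫_ℝ = Real.cos α →
      ∀ cQ cP : ℝ, 0 < cQ → 0 < cP →
      ((∃ ρ : QVar.State (QVar.Hilb n), QVar.FiniteSecondMoments hbar ρ ∧
          QVar.varianceQAlong u ρ = cQ ∧ QVar.variancePAlong hbar v ρ = cP) ↔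
        (hbar / 2 * Real.cos α) ^ 2 ≤ cQ * cP)) := by
  refine ⟨fun A B hA hB => ?_, fun u v α hu hv huv cQ cP hQ hP => ?_⟩
  · simp only [QVar.quantumVarianceMatrix, Matrix.toBlocks_fromBlocks₁₁,
      Matrix.toBlocks_fromBlocks₂₂]
    constructor
    · rintro ⟨ρ, hρ, rfl, rfl⟩
      exact QVar.posSemidef_varP_sub hρ hA hB
    · exact QVar.exists_state_of_posSemidef hbar_pos.ne' hA hB.posSemidef
  · rw [← huv]
    constructor
    · rintro ⟨ρ, hρ, rfl, rfl⟩
      exact QVar.uncertainty hbar ρ hρ u v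
    · exact QVar.exists_state_of_le hbar_pos hu hv hQ hP
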